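/- Let $H$ be a separable infinite-dimensional complex Hilbert space, $B(H)$ the algebra of bounded linear operators on $H$; a $B(H)$-ideal is a two-sided ideal of $B(H)$. For $S\in B(H)$ let $(S)$ be the smallest $B(H)$-ideal containing $S$, and for $B(H)$-ideals $I,J$ let $IJ$ be the set of finite sums $\sum_i a_ib_i$ with $a_i\in I$, $b_i\in J$. Let $J$ be a $B(H)$-ideal. A $J$-ideal is a two-sided ideal of the ring $J$, i.e. an additive subgroup $\mathcal I\subseteq J$ with $A X, X A\in\mathcal I$ for all $A\in J$, $X\in\mathcal I$; it is linear (real linear) if it is closed under multiplication by complex (real) scalars. For $S\in J$ let $\langle S\rangle_J$, $(S)_J$, $(S)_J^{\mathbb R}$ be the intersection of all $J$-ideals, of all linear $J$-ideals, and of all real linear $J$-ideals containing $S$, respectively. For $T\in B(H)$ let $s(T)=(s_n(T))_{n\ge 1}$ be the sequence of singular numbers, $s_n(T)=\inf\{\|T-F\| : F\in B(H),\ \operatorname{rank}F<n\}$ (for compact $T$, the eigenvalues of $(T^*T)^{1/2}$ in decreasing order, repeated according to multiplicity and followed by zeros if there are only finitely many), and for an integer $k\ge1$ and a sequence $\xi$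 let $D_k\xi=(\xi_1,\dots,\xi_1,\xi_2,\dots,\xi_2,\dots)$, each entry repeated $k$ times. Products of sequences are pointwise. **Theorem.** Let $J$ be a $B(H)$-ideal and $S\in J$. The following are equivalent. (i) Any one of $\langle S\rangle_J$, $(S)_J$, $(S)_J^{\mathbb R}$ is a $B(H)$-ideal. (The three conditions, one for each of these $J$-ideals, are equivalent to each other and to each of the conditions below; so "some one of them" and "every one of them" mean the same.) (ii) The ideal $(S)$ is $J$-soft, i.e. $(S)J=(S)$; equivalently, $(S)=J(S)$. (iii) $S=AS+SB+\sum_{i=1}^m A_iSB_i$ for some integer $m\ge1$ and some $A,B,A_i,B_i\in J$. (iv) $s(S)=O\bigl(D_k(s(S))\,s(T)\bigr)$ for some $T\in J$ and some integer $k\ge1$. -/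

import Mathlib

open Asymptotics Filter

noncomputable section

namespace Subideal

variable {H : Type*} [NormedAddCommGroup H] [InnerProductSpace ℂ H]

/-- The `n`-th singular number of a bounded operator on a Hilbert space, indexed from `0`:
the distance of `T` to the operators of rank at most `n`. So `singularNumber T 0 = ‖T‖`, and for
compact `T` this is the decreasing list of the eigenvalues of `(T* T)^(1/2)`, repeated by
multiplicity and followed by zeros if there are only finitely many. -/
def singularNumber (T : H →L[ℂ] H) (n : ℕ) : ℝ :=
  sInf {d : ℝ | ∃ F : H →L[ℂ] H, (F : H →ₗ[ℂ] H).rank ≤ (n : Cardinal) ∧ d = ‖T - F‖}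

/-- The `k`-fold ampliation `(ξ₀, …, ξ₀, ξ₁, …, ξ₁, …)`, each entry repeated `k` times
(meaningful for `0 < k`). -/
def ampliation (k : ℕ) (ξ : ℕ → ℝ) : ℕ → ℝ := fun n => ξ (n / k)

/-- The product `I J` of two ideals of `B(H)`: all finite sums of products `a b` with `a ∈ I` and
`b ∈ J`. -/
def idealProd (I J : TwoSidedIdeal (H →L[ℂ] H)) : Set (H →L[ℂ] H) :=
  {X | ∃ (n : ℕ) (a b : Fin n → (H →L[ℂ] H)),
    (∀ i, a i ∈ I) ∧ (∀ i, b i ∈ J) ∧ X = ∑ i, a i * b i}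

/-- The ideal `I` of `B(H)` is `J`-soft: `I J = I`. -/
def IsSoft (J I : TwoSidedIdeal (H →L[ℂ] H)) : Prop :=
  idealProd I J = (I : Set (H →L[ℂ] H))

/-- `I` is a `J`-ideal, that is, a two-sided ideal of the ring `J`: an additive subgroup contained
in `J` and closed under left and right multiplication by elements of `J`. -/
structure IsIdealIn (J : TwoSidedIdeal (H →L[ℂ] H)) (I : AddSubgroup (H →L[ℂ] H)) : Prop where
  subset : ∀ X ∈ I, X ∈ J
  mul_mem_left : ∀ A ∈ J, ∀ X ∈ I, A * X ∈ I
  mul_mem_right : ∀ A ∈ J, ∀ X ∈ I, X * A ∈ I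

/-- `I` is a linear `J`-ideal: a `J`-ideal closed under complex scalar multiplication. -/
structure IsLinearIdealIn (J : TwoSidedIdeal (H →L[ℂ] H)) (I : AddSubgroup (H →L[ℂ] H)) : Prop
    extends IsIdealIn J I where
  smul_mem : ∀ (c : ℂ), ∀ X ∈ I, c • X ∈ I

/-- `I` is a real linear `J`-ideal: a `J`-ideal closed under real scalar multiplication. -/
structure IsRealLinearIdealIn (J : TwoSidedIdeal (H →L[ℂ] H)) (I : AddSubgroup (H →L[ℂ] H)) :
    Prop extends IsIdealIn J I where
  smul_mem : ∀ (r : ℝ), ∀ X ∈ I, (r : ℂ) • X ∈ I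

/-- The principal ideal `(S)` of `B(H)`: the smallest two-sided ideal containing `S`. -/
def principalIdeal (S : H →L[ℂ] H) : TwoSidedIdeal (H →L[ℂ] H) :=
  sInf {I | S ∈ I}

/-- The principal `J`-ideal `⟨S⟩_J`: the intersection of all `J`-ideals containing `S`. -/
def principalIn (J : TwoSidedIdeal (H →L[ℂ] H)) (S : H →L[ℂ] H) : AddSubgroup (H →L[ℂ] H) :=
  sInf {I | IsIdealIn J I ∧ S ∈ I}

/-- The principal linear `J`-ideal `(S)_J`: the intersection of all linear `J`-ideals
containing `S`. -/
def principalLinearIn (J : TwoSidedIdeal (H →L[ℂ] H)) (S : H →L[ℂ] H) :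
    AddSubgroup (H →L[ℂ] H) :=
  sInf {I | IsLinearIdealIn J I ∧ S ∈ I}

/-- The principal real linear `J`-ideal `(S)_J^ℝ`: the intersection of all real linear `J`-ideals
containing `S`. -/
def principalRealLinearIn (J : TwoSidedIdeal (H →L[ℂ] H)) (S : H →L[ℂ] H) :
    AddSubgroup (H →L[ℂ] H) :=
  sInf {I | IsRealLinearIdealIn J I ∧ S ∈ I}

/-- The additive subgroup `I` of `B(H)` is a two-sided ideal of `B(H)`. -/
def IsBHIdeal (I : AddSubgroup (H →L[ℂ] H)) : Prop :=
  ∃ K : TwoSidedIdeal (H →L[ℂ] H), (K : Set (H →L[ℂ] H)) = (I : Set (H →L[ℂ] H))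

end Subideal

end

noncomputable section

namespace Subideal

variable {H : Type*} [NormedAddCommGroup H] [InnerProductSpace ℂ H]

/-! ### Singular numbers -/

/-! Everything passes through condition (iv). Calkin's correspondence makes this possible: if `s(T)`
tends to `0`, an ideal contains `T` exactly when it contains the diagonal operator with diagonal
`s(T)` (`mem_iff_diag_singularNumber_mem`, by the Schmidt decomposition). Otherwise `T` generates
all of `B(H)` (`eq_top_of_not_tendsto_singularNumber`).

Towards (iv), let `K` be `dominatedIdeal b J S`. Since `s_{2n}(AB) ≤ s_n(A) s_n(B)`, it contains
`AS` and `SA` for `A ∈ J`, hence `J(S)`, `(S)J` and every right-hand side of (iii). As `S ∈ K`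
yields (iv), conditions (ii) and (iii) are settled. For (i), every element of `(S)_J` is a scalar
multiple of `S` modulo `K`. If one of the three principal `J`-ideals is a `B(H)`-ideal, then `XS ∈
ℂS + K` for all `X`. Were `S ∉ K`, the scalar would be a character of `B(H)`, and `B(H)` has none
(`mem_of_forall_exists_smul`).

Conversely, (iv) factors the diagonal of `s(S)` through a diagonal in `(S)` and one in `J`, so `S`
lies in `J(S)` and in `(S)J`, hence in `J(S)J`. Thus `S = ∑ A_i S B_i` with `A_i, B_i ∈ J`. This is
(iii), and it lets outer factors from `B(H)` be absorbed into `J`, so that a `J`-ideal containing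
`S` contains `(S)`. -/

lemma bddBelow_singularNumber_set (T : H →L[ℂ] H) (n : ℕ) :
    BddBelow {d : ℝ | ∃ F : H →L[ℂ] H, (F : H →ₗ[ℂ] H).rank ≤ (n : Cardinal) ∧ d = ‖T - F‖} :=
  ⟨0, by rintro d ⟨F, -, rfl⟩; exact norm_nonneg _⟩

lemma singularNumber_le (T F : H →L[ℂ] H) (n : ℕ)
    (hF : (F : H →ₗ[ℂ] H).rank ≤ (n : Cardinal)) : singularNumber T n ≤ ‖T - F‖ :=
  csInf_le (bddBelow_singularNumber_set T n) ⟨F, hF, rfl⟩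

lemma le_singularNumber (T : H →L[ℂ] H) (n : ℕ) (c : ℝ)
    (h : ∀ F : H →L[ℂ] H, (F : H →ₗ[ℂ] H).rank ≤ (n : Cardinal) → c ≤ ‖T - F‖) :
    c ≤ singularNumber T n := by
  refine le_csInf ⟨‖T - 0‖, 0, by simp, rfl⟩ ?_
  rintro d ⟨F, hF, rfl⟩
  exact h F hF

lemma singularNumber_nonneg (T : H →L[ℂ] H) (n : ℕ) : 0 ≤ singularNumber T n :=
  le_singularNumber T n 0 fun _ _ => norm_nonneg _

lemma exists_norm_sub_lt (T : H →L[ℂ] H) (n : ℕ) {c : ℝ} (h : singularNumber T n < c) :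
    ∃ F : H →L[ℂ] H, (F : H →ₗ[ℂ] H).rank ≤ (n : Cardinal) ∧ ‖T - F‖ < c := by
  by_contra! hc
  exact absurd (le_singularNumber T n c hc) (not_le.mpr h)

lemma singularNumber_antitone (T : H →L[ℂ] H) : Antitone (singularNumber T) := by
  intro m n hmn
  refine le_singularNumber T m _ fun F hF => singularNumber_le T F n (hF.trans ?_)
  exact_mod_cast hmn

lemma singularNumber_le_norm (T : H →L[ℂ] H) (n : ℕ) : singularNumber T n ≤ ‖T‖ := by
  simpa using singularNumber_le T 0 n (by simp)

lemma singularNumber_add_le (A B : H →L[ℂ] H) (m n : ℕ) :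
    singularNumber (A + B) (m + n) ≤ singularNumber A m + singularNumber B n := by
  refine le_of_forall_pos_lt_add fun ε hε => ?_
  obtain ⟨F, hF, hF'⟩ := exists_norm_sub_lt A m
    (show singularNumber A m < singularNumber A m + ε / 2 by linarith)
  obtain ⟨G, hG, hG'⟩ := exists_norm_sub_lt B n
    (show singularNumber B n < singularNumber B n + ε / 2 by linarith)
  have hrank : ((F + G : H →L[ℂ] H) : H →ₗ[ℂ] H).rank ≤ ((m + n : ℕ) : Cardinal) := by
    push_cast
    exact (LinearMap.rank_add_le _ _).trans (add_le_add hF hG)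
  have h := singularNumber_le (A + B) (F + G) (m + n) hrank
  have h2 : ‖A + B - (F + G)‖ ≤ ‖A - F‖ + ‖B - G‖ := by
    rw [add_sub_add_comm]; exact norm_add_le _ _
  linarith

/-- If `F` and `G` approximate `A` and `B`, then `(A - F)(B - G)` differs from `AB` by `F(B - G) +
AG`, of rank at most `m + n`. -/
lemma singularNumber_mul_le (A B : H →L[ℂ] H) (m n : ℕ) :
    singularNumber (A * B) (m + n) ≤ singularNumber A m * singularNumber B n := by
  have key : ∀ a, singularNumber A m < a → ∀ b, singularNumber B n < b →
      singularNumber (A * B) (m + n) ≤ a * b := by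
    intro a ha b hb
    obtain ⟨F, hF, hF'⟩ := exists_norm_sub_lt A m ha
    obtain ⟨G, hG, hG'⟩ := exists_norm_sub_lt B n hb
    have hrank : ((F * (B - G) + A * G : H →L[ℂ] H) : H →ₗ[ℂ] H).rank
        ≤ ((m + n : ℕ) : Cardinal) := by
      push_cast
      refine (LinearMap.rank_add_le _ _).trans (add_le_add ?_ ?_)
      · exact (LinearMap.rank_comp_le_left ((B - G : H →L[ℂ] H) : H →ₗ[ℂ] H)
          (F : H →ₗ[ℂ] H)).trans hF
      · exact (LinearMap.rank_comp_le_right (G : H →ₗ[ℂ] H) (A : H →ₗ[ℂ] H)).trans hG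
    have h := singularNumber_le (A * B) _ (m + n) hrank
    have h2 : A * B - (F * (B - G) + A * G) = (A - F) * (B - G) := by
      simp only [mul_sub, sub_mul]; abel
    rw [h2] at h
    refine h.trans ((norm_mul_le _ _).trans ?_)
    exact mul_le_mul hF'.le hG'.le (norm_nonneg _) ((norm_nonneg _).trans hF'.le)
  have h1 : ∀ a, singularNumber A m < a →
      singularNumber (A * B) (m + n) ≤ a * singularNumber B n := by
    intro a ha
    have ha0 : 0 < a := (singularNumber_nonneg A m).trans_lt ha
    rw [← div_le_iff₀' ha0]
    refine le_of_forall_gt_imp_ge_of_dense fun b hb => ?_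
    rw [div_le_iff₀' ha0]
    exact key a ha b hb
  -- The infimum over `a` is taken by dividing by `s_n(B)`, so the value zero needs its own case.
  rcases (singularNumber_nonneg B n).eq_or_lt with h0 | h0
  · have := h1 (singularNumber A m + 1) (by linarith)
    rw [← h0] at this ⊢
    simpa using this
  · rw [← div_le_iff₀ h0]
    refine le_of_forall_gt_imp_ge_of_dense fun a ha => ?_
    rw [div_le_iff₀ h0]
    exact h1 a ha

lemma singularNumber_mul_le_left (A B : H →L[ℂ] H) (n : ℕ) :
    singularNumber (A * B) n ≤ ‖A‖ * singularNumber B n := by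
  have h := singularNumber_mul_le A B 0 n
  rw [zero_add] at h
  exact h.trans (mul_le_mul_of_nonneg_right (singularNumber_le_norm A 0)
    (singularNumber_nonneg B n))

lemma singularNumber_mul_le_right (A B : H →L[ℂ] H) (n : ℕ) :
    singularNumber (A * B) n ≤ singularNumber A n * ‖B‖ :=
  (singularNumber_mul_le A B n 0).trans (mul_le_mul_of_nonneg_left (singularNumber_le_norm B 0)
    (singularNumber_nonneg A n))

lemma singularNumber_neg (A : H →L[ℂ] H) (n : ℕ) :
    singularNumber (-A) n = singularNumber A n := by
  have h : ∀ B : H →L[ℂ] H, singularNumber (-B) n ≤ singularNumber B n := fun B =>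
    le_singularNumber B n _ fun F hF => by
      have h := singularNumber_le (-B) (-F) n (by
        have : ((-F : H →L[ℂ] H) : H →ₗ[ℂ] H) = (-LinearMap.id) ∘ₗ (F : H →ₗ[ℂ] H) := by
          ext; simp
        rw [this]
        exact (LinearMap.rank_comp_le_right _ _).trans hF)
      rwa [neg_sub_neg, ← norm_neg, neg_sub] at h
  exact le_antisymm (h A) (by simpa using h (-A))

/-- An operator bounded below by `c` on a subspace of dimension larger than `n` has `n`-th singular
number at least `c`. -/
lemma le_singularNumber_of_finrank_lt (T : H →L[ℂ] H) (n : ℕ) (c : ℝ) (W : Submodule ℂ H)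
    [FiniteDimensional ℂ W] (hW : n < Module.finrank ℂ W)
    (h : ∀ x ∈ W, c * ‖x‖ ≤ ‖T x‖) : c ≤ singularNumber T n := by
  refine le_singularNumber T n c fun F hF => ?_
  have hfin : FiniteDimensional ℂ (LinearMap.range (F : H →ₗ[ℂ] H)) :=
    Module.rank_lt_aleph0_iff.mp (hF.trans_lt Cardinal.natCast_lt_aleph0)
  have hlt : Module.finrank ℂ (LinearMap.range (F : H →ₗ[ℂ] H)) < Module.finrank ℂ W := by
    refine lt_of_le_of_lt ?_ hW
    exact Module.finrank_le_of_rank_le hF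
  obtain ⟨x, hx, hx0⟩ := Submodule.exists_mem_ne_zero_of_ne_bot
    (LinearMap.ker_ne_bot_of_finrank_lt (f := (F : H →ₗ[ℂ] H).rangeRestrict ∘ₗ W.subtype) hlt)
  have hFx : F (x : H) = 0 := by
    have := congrArg Subtype.val (LinearMap.mem_ker.mp hx)
    simpa using this
  have hpos : 0 < ‖(x : H)‖ := norm_pos_iff.mpr (by simpa using hx0)
  have h1 : ‖T x‖ ≤ ‖T - F‖ * ‖(x : H)‖ := by
    simpa [hFx] using (T - F).le_opNorm (x : H)
  exact le_of_mul_le_mul_right ((h x x.2).trans h1) hpos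

/-! ### Operators given by their values on a Hilbert basis -/

lemma exists_hilbertBasis_nat [CompleteSpace H] [TopologicalSpace.SeparableSpace H]
    (hH : ¬ FiniteDimensional ℂ H) : Nonempty (HilbertBasis ℕ ℂ H) := by
  obtain ⟨w, b, hb⟩ := exists_hilbertBasis ℂ H
  have hon : Orthonormal ℂ ((↑) : w → H) := hb ▸ b.orthonormal
  have hc : Countable w := by
    -- Distinct orthonormal vectors are at distance `√2 > 1`, so balls of radius `1/2` about them
    -- are disjoint.
    refine Pairwise.countable_of_isOpen_disjoint
      (s := fun x : w => Metric.ball (x : H) (1 / 2)) ?_ (fun _ => Metric.isOpen_ball)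
      (fun x => ⟨x, Metric.mem_ball_self (by norm_num)⟩)
    intro x y hxy
    refine Metric.ball_disjoint_ball ?_
    have h2 : dist (x : H) (y : H) ^ 2 = 2 := by
      rw [dist_eq_norm, @norm_sub_sq ℂ, hon.1 x, hon.1 y, hon.2 hxy]; norm_num
    nlinarith [dist_nonneg (x := (x : H)) (y := (y : H))]
  have hi : Infinite w := by
    by_contra hfin
    rw [not_infinite_iff_finite] at hfin
    have := Fintype.ofFinite w
    exact hH (b.toOrthonormalBasis.toBasis.finiteDimensional_of_finite)
  obtain ⟨e⟩ := nonempty_equiv_of_countable (α := ℕ) (β := w)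
  refine ⟨HilbertBasis.mk (v := fun n => (e n : H)) (hon.comp e e.injective) ?_⟩
  have : Set.range (fun n => (e n : H)) = Set.range b := by
    rw [hb]
    exact e.surjective.range_comp ((↑) : w → H)
  rw [this, b.dense_span]

/-- By Pythagoras `∑ x_i g_i` converges with norm at most `C‖x‖`. The `g_i` may vanish and need not
be normalized, so isometries, their adjoints and diagonal operators all come from this one
construction. -/
lemma exists_apply_basis_eq [CompleteSpace H] (b : HilbertBasis ℕ ℂ H) (g : ℕ → H)
    (hg : Pairwise fun i j => inner ℂ (g i) (g j) = 0) (C : ℝ) (hC : ∀ n, ‖g n‖ ≤ C) :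
    ∃ A : H →L[ℂ] H, ∀ n, A (b n) = g n := by
  have hC0 : 0 ≤ C := (norm_nonneg _).trans (hC 0)
  have hV : OrthogonalFamily ℂ (fun i => Submodule.span ℂ {g i})
      (fun i => (Submodule.span ℂ {g i}).subtypeₗᵢ) := by
    intro i j hij v w
    obtain ⟨a, ha⟩ := Submodule.mem_span_singleton.mp v.2
    obtain ⟨c, hc⟩ := Submodule.mem_span_singleton.mp w.2
    simp [← ha, ← hc, inner_smul_left, inner_smul_right, hg hij]
  let v : ∀ (x : H) (i : ℕ), Submodule.span ℂ {g i} := fun x i =>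
    b.repr x i • ⟨g i, Submodule.mem_span_singleton_self _⟩
  have hv : ∀ x i, ‖v x i‖ ^ 2 ≤ C ^ 2 * ‖b.repr x i‖ ^ 2 := by
    intro x i
    have h1 : ‖v x i‖ = ‖b.repr x i‖ * ‖g i‖ := by simp [v, norm_smul]
    rw [h1, mul_pow, mul_comm]
    gcongr
    exact hC i
  have hsum : ∀ x, HasSum (fun i => ‖b.repr x i‖ ^ 2) (‖x‖ ^ 2) := by
    intro x
    have h := lp.hasSum_norm (p := 2) (by norm_num) (b.repr x)
    simpa using h
  have hs : ∀ x, Summable fun i => b.repr x i • g i := by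
    intro x
    have := (hV.summable_iff_norm_sq_summable (v x)).mpr
      (Summable.of_nonneg_of_le (fun _ => sq_nonneg _) (hv x) ((hsum x).summable.mul_left _))
    simpa [v] using this
  have hbound : ∀ x, ‖∑' i, b.repr x i • g i‖ ≤ C * ‖x‖ := by
    intro x
    refine le_of_tendsto ((hs x).hasSum.norm) (Eventually.of_forall fun s => ?_)
    have h1 := hV.norm_sum (v x) s
    have h2 : ∑ i ∈ s, ‖v x i‖ ^ 2 ≤ C ^ 2 * ‖x‖ ^ 2 := by
      refine (Finset.sum_le_sum fun i _ => hv x i).trans ?_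
      rw [← Finset.mul_sum]
      gcongr
      exact sum_le_hasSum s (fun _ _ => sq_nonneg _) (hsum x)
    refine le_of_sq_le_sq ?_ (by positivity)
    rw [mul_pow]
    calc _ = ‖∑ i ∈ s, (Submodule.span ℂ {g i}).subtypeₗᵢ (v x i)‖ ^ 2 := by simp [v]
      _ ≤ _ := h1.trans_le h2
  let L : H →ₗ[ℂ] H :=
    { toFun := fun x => ∑' i, b.repr x i • g i
      map_add' := fun x y => by
        rw [← (hs x).tsum_add (hs y)]
        simp [add_smul]
      map_smul' := fun c x => by
        rw [RingHom.id_apply, ← tsum_const_smul'']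
        simp [mul_smul] }
  refine ⟨L.mkContinuous C hbound, fun n => ?_⟩
  change ∑' i, b.repr (b n) i • g i = g n
  rw [tsum_eq_single n]
  · simp [b.repr_self]
  · intro m hm
    simp [b.repr_self, hm]

lemma ext_basis (b : HilbertBasis ℕ ℂ H) {A B : H →L[ℂ] H} (h : ∀ n, A (b n) = B (b n)) :
    A = B := by
  refine ContinuousLinearMap.ext_on (s := Set.range b)
    (Submodule.dense_iff_topologicalClosure_eq_top.mpr b.dense_span) ?_
  rintro _ ⟨n, rfl⟩
  exact h n

/-- The diagonal operator with respect to `b` with bounded real diagonal `d` (zero if `d` is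
unbounded). -/
def diag (b : HilbertBasis ℕ ℂ H) (d : ℕ → ℝ) : H →L[ℂ] H :=
  open Classical in
  if h : ∃ A : H →L[ℂ] H, ∀ n, A (b n) = (d n : ℂ) • b n then h.choose else 0

lemma diag_apply [CompleteSpace H] (b : HilbertBasis ℕ ℂ H) {d : ℕ → ℝ} {C : ℝ}
    (hd : ∀ n, |d n| ≤ C) (n : ℕ) : diag b d (b n) = (d n : ℂ) • b n := by
  have h : ∃ A : H →L[ℂ] H, ∀ n, A (b n) = (d n : ℂ) • b n := by
    refine exists_apply_basis_eq b _ ?_ C fun n => ?_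
    · intro i j hij
      simp [b.orthonormal.2 hij]
    · simpa [norm_smul, b.orthonormal.1 n] using hd n
  rw [diag, dif_pos h]
  exact h.choose_spec n

lemma diag_mul [CompleteSpace H] (b : HilbertBasis ℕ ℂ H) {d d' : ℕ → ℝ} {C C' : ℝ}
    (hd : ∀ n, |d n| ≤ C) (hd' : ∀ n, |d' n| ≤ C') :
    diag b (fun n => d n * d' n) = diag b d * diag b d' := by
  have hC : ∀ n, |d n * d' n| ≤ C * C' := fun n => by
    rw [abs_mul]
    exact mul_le_mul (hd n) (hd' n) (abs_nonneg _) ((abs_nonneg _).trans (hd n))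
  refine ext_basis b fun n => ?_
  rw [diag_apply b hC, mul_apply_eq_comp, diag_apply b hd', map_smul,
    diag_apply b hd, smul_smul]
  push_cast
  rw [mul_comm]

lemma diag_add [CompleteSpace H] (b : HilbertBasis ℕ ℂ H) {d d' : ℕ → ℝ} {C C' : ℝ}
    (hd : ∀ n, |d n| ≤ C) (hd' : ∀ n, |d' n| ≤ C') :
    diag b (fun n => d n + d' n) = diag b d + diag b d' := by
  have hC : ∀ n, |d n + d' n| ≤ C + C' := fun n =>
    (abs_add_le _ _).trans (add_le_add (hd n) (hd' n))
  refine ext_basis b fun n => ?_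
  rw [diag_apply b hC, add_apply, diag_apply b hd', diag_apply b hd]
  push_cast
  rw [add_smul]

/-- The quotient `y / x` is bounded by `K`, so `diag b y` is a bounded multiple of `diag b x`; where
`x` vanishes, so does `y`. -/
lemma diag_mem_of_le [CompleteSpace H] (b : HilbertBasis ℕ ℂ H) {I : TwoSidedIdeal (H →L[ℂ] H)}
    {x y : ℕ → ℝ} {C K : ℝ} (hx : ∀ n, |x n| ≤ C) (hI : diag b x ∈ I) (hK : 0 ≤ K)
    (hy : ∀ n, |y n| ≤ K * |x n|) : diag b y ∈ I := by
  have h : y = fun n => (y n / x n) * x n := by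
    funext n
    by_cases h0 : x n = 0
    · have := hy n
      simp [h0] at this
      simp [h0, this]
    · field_simp
  rw [h, diag_mul b (C := K) (fun n => ?_) hx]
  · exact I.mul_mem_left _ _ hI
  · rw [abs_div]
    exact div_le_of_le_mul₀ (abs_nonneg _) hK (hy n)

lemma inner_basis (b : HilbertBasis ℕ ℂ H) (i j : ℕ) :
    inner ℂ (b i) (b j) = if i = j then 1 else 0 :=
  orthonormal_iff_ite.mp b.orthonormal i j

/-- The ampliation is a sum of `k` copies of `diag b x`, the `r`-th one transported to the basis
vectors with index congruent to `r` modulo `k`. -/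
lemma diag_ampliation_mem [CompleteSpace H] (b : HilbertBasis ℕ ℂ H)
    {I : TwoSidedIdeal (H →L[ℂ] H)} {x : ℕ → ℝ} {C : ℝ} (hx : ∀ n, |x n| ≤ C) {k : ℕ} (hk : 0 < k)
    (hI : diag b x ∈ I) : diag b (ampliation k x) ∈ I := by
  have hW : ∀ r : ℕ, ∃ A : H →L[ℂ] H, ∀ n, A (b n) = b (k * n + r) := fun r =>
    exists_apply_basis_eq b _ (fun i j hij => by
      dsimp only
      rw [inner_basis, if_neg]
      intro h
      exact hij (Nat.eq_of_mul_eq_mul_left hk (by omega))) 1 (fun n => (b.orthonormal.1 _).le)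
  have hW' : ∀ r : ℕ, ∃ A : H →L[ℂ] H, ∀ n, A (b n) = if n % k = r then b (n / k) else 0 :=
    fun r => exists_apply_basis_eq b _ (fun i j hij => by
      dsimp only
      split_ifs with h1 h2
      · rw [inner_basis, if_neg]
        intro h
        apply hij
        rw [← Nat.div_add_mod i k, ← Nat.div_add_mod j k, h, h1, h2]
      all_goals simp) 1 (fun n => by
        split_ifs
        · exact (b.orthonormal.1 _).le
        · simp)
  choose W hW using hW
  choose W' hW' using hW'
  have hsum : diag b (ampliation k x) = ∑ r ∈ Finset.range k, W r * diag b x * W' r := by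
    refine ext_basis b fun n => ?_
    rw [diag_apply b (d := ampliation k x) (C := C) (fun n => hx _), sum_apply,
      Finset.sum_eq_single (n % k)]
    · simp only [mul_apply_eq_comp, hW', if_true, diag_apply b hx, map_smul, hW,
        ampliation, Nat.div_add_mod]
    · intro r _ hr
      simp [hW', hr.symm]
    · intro h
      exact absurd (Finset.mem_range.mpr (Nat.mod_lt _ hk)) h
  rw [hsum]
  exact sum_mem fun r _ => I.mul_mem_right _ _ (I.mul_mem_left _ _ hI)

lemma norm_sq_sum_smul (b : HilbertBasis ℕ ℂ H) (c : ℕ → ℂ) (s : Finset ℕ) :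
    ‖∑ i ∈ s, c i • b i‖ ^ 2 = ∑ i ∈ s, ‖c i‖ ^ 2 := by
  have h := b.orthonormal.inner_sum c c s
  have h2 := inner_self_eq_norm_sq_to_K (𝕜 := ℂ) (∑ i ∈ s, c i • b i)
  rw [h] at h2
  have h3 : ∀ i, (starRingEnd ℂ) (c i) * c i = ((‖c i‖ ^ 2 : ℝ) : ℂ) := fun i => by
    rw [mul_comm, RCLike.mul_conj]; simp
  simp only [h3] at h2
  have h4 : ((‖∑ i ∈ s, c i • b i‖ ^ 2 : ℝ) : ℂ) = ((∑ i ∈ s, ‖c i‖ ^ 2 : ℝ) : ℂ) := by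
    simpa using h2.symm
  exact_mod_cast h4

/-- On the `(n + 1)`-dimensional span of `b 0, …, b n` the operator is bounded below by `x n`. -/
lemma le_singularNumber_diag [CompleteSpace H] (b : HilbertBasis ℕ ℂ H) {x : ℕ → ℝ}
    (hx : Antitone x) (hx0 : ∀ n, 0 ≤ x n) (n : ℕ) : x n ≤ singularNumber (diag b x) n := by
  have hb : ∀ n, |x n| ≤ x 0 := fun n => by
    rw [abs_of_nonneg (hx0 n)]; exact hx (Nat.zero_le n)
  have hli : LinearIndependent ℂ (fun i : Fin (n + 1) => b i) :=
    b.orthonormal.linearIndependent.comp _ Fin.val_injective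
  have hfr := finrank_span_eq_card hli
  have : FiniteDimensional ℂ (Submodule.span ℂ (Set.range fun i : Fin (n + 1) => b i)) :=
    FiniteDimensional.span_of_finite ℂ (Set.finite_range _)
  refine le_singularNumber_of_finrank_lt _ n _
    (Submodule.span ℂ (Set.range fun i : Fin (n + 1) => b i)) (by rw [hfr]; simp) ?_
  intro y hy
  obtain ⟨c', rfl⟩ := (Submodule.mem_span_range_iff_exists_fun ℂ).mp hy
  let c : ℕ → ℂ := fun i => if h : i < n + 1 then c' ⟨i, h⟩ else 0
  have hc : ∑ i, c' i • b (i : ℕ) = ∑ i ∈ Finset.range (n + 1), c i • b i := by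
    rw [← Fin.sum_univ_eq_sum_range (fun i => c i • b i)]
    exact Finset.sum_congr rfl fun i _ => by simp only [c, dif_pos i.isLt]
  rw [hc]
  refine le_of_sq_le_sq ?_ (norm_nonneg _)
  have h1 : diag b x (∑ i ∈ Finset.range (n + 1), c i • b i)
      = ∑ i ∈ Finset.range (n + 1), (c i * x i) • b i := by
    simp only [map_sum, map_smul, diag_apply b hb, smul_smul]
  rw [h1, mul_pow, norm_sq_sum_smul, norm_sq_sum_smul, Finset.mul_sum]
  refine Finset.sum_le_sum fun i hi => ?_
  rw [norm_mul, mul_pow, mul_comm]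
  have : x n ≤ x i := hx (by simpa [Nat.lt_succ_iff] using hi)
  have h2 : ‖((x i : ℝ) : ℂ)‖ = x i := by simp [abs_of_nonneg (hx0 i)]
  rw [h2]
  have := hx0 n
  gcongr

/-! ### Schmidt decomposition -/

lemma ext_inner_basis (b : HilbertBasis ℕ ℂ H) {x y : H}
    (h : ∀ m, inner ℂ (b m) x = inner ℂ (b m) y) : x = y := by
  refine b.repr.injective (lp.ext (funext fun m => ?_))
  rw [b.repr_apply_apply, b.repr_apply_apply, h]

lemma exists_mem_orthogonal_norm_eq_one (hH : ¬ FiniteDimensional ℂ H) (W : Submodule ℂ H)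
    [FiniteDimensional ℂ W] : ∃ e ∈ Wᗮ, ‖e‖ = 1 := by
  have hne : Wᗮ ≠ ⊥ := by
    intro h
    have : W = ⊤ := by
      rw [← Submodule.orthogonal_orthogonal W, h, Submodule.bot_orthogonal_eq_top]
    subst this
    exact hH (Module.Finite.equiv (Submodule.topEquiv (R := ℂ) (M := H)))
  obtain ⟨x, hx, hx0⟩ := Submodule.exists_mem_ne_zero_of_ne_bot hne
  refine ⟨((‖x‖⁻¹ : ℝ) : ℂ) • x, Submodule.smul_mem _ _ hx, ?_⟩
  rw [norm_smul]
  simp [norm_ne_zero_iff.mpr hx0]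

lemma isCompactOperator_of_rank_le (F : H →L[ℂ] H) (n : ℕ)
    (hF : (F : H →ₗ[ℂ] H).rank ≤ (n : Cardinal)) : IsCompactOperator F := by
  have hfin : FiniteDimensional ℂ (LinearMap.range (F : H →ₗ[ℂ] H)) :=
    Module.rank_lt_aleph0_iff.mp (hF.trans_lt Cardinal.natCast_lt_aleph0)
  have : ProperSpace (LinearMap.range (F : H →ₗ[ℂ] H)) := FiniteDimensional.proper ℂ _
  have h := isCompactOperator_of_locallyCompactSpace_dom
    (F.codRestrict (LinearMap.range (F : H →ₗ[ℂ] H)) (fun x => ⟨x, rfl⟩))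
  exact h.clm_comp (LinearMap.range (F : H →ₗ[ℂ] H)).subtypeL

lemma isCompactOperator_of_tendsto_singularNumber [CompleteSpace H] (T : H →L[ℂ] H)
    (hT : Tendsto (singularNumber T) atTop (nhds 0)) : IsCompactOperator T := by
  have h : ∀ n : ℕ, ∃ F : H →L[ℂ] H, (F : H →ₗ[ℂ] H).rank ≤ (n : Cardinal) ∧
      ‖T - F‖ < singularNumber T n + 1 / ((n : ℝ) + 1) := fun n =>
    exists_norm_sub_lt T n (lt_add_of_pos_right _ Nat.one_div_pos_of_nat)
  choose F hF hF' using h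
  refine isCompactOperator_of_tendsto (F := F) (l := atTop) ?_
    (Eventually.of_forall fun n => isCompactOperator_of_rank_le _ n (hF n))
  rw [tendsto_iff_norm_sub_tendsto_zero]
  refine squeeze_zero (fun _ => norm_nonneg _) (fun n => ?_)
    (by simpa only [add_zero] using hT.add (tendsto_one_div_add_atTop_nhds_zero_nat (𝕜 := ℝ)))
  rw [norm_sub_rev]
  exact (hF' n).le

/-- The self-adjoint operator `R*R` has a spectral value of modulus `‖R‖² ≠ 0`; by compactness it is
an eigenvalue, and `R` attains its norm at a unit eigenvector. -/
lemma exists_singular_vector [CompleteSpace H] (R : H →L[ℂ] H) (hR : IsCompactOperator R)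
    (h0 : R ≠ 0) : ∃ (e : H) (μ : ℂ), ‖e‖ = 1 ∧ μ ≠ 0 ∧ ‖R e‖ = ‖R‖ ∧
      ContinuousLinearMap.adjoint R (R e) = μ • e := by
  set A : H →L[ℂ] H := ContinuousLinearMap.adjoint R * R with hA
  have hAc : IsCompactOperator A := hR.clm_comp (ContinuousLinearMap.adjoint R)
  have hAn : ‖A‖ = ‖R‖ * ‖R‖ := CStarRing.norm_star_mul_self (x := R)
  have hRpos : 0 < ‖R‖ := norm_pos_iff.mpr h0
  have : Nontrivial H := by
    by_contra h
    rw [not_nontrivial_iff_subsingleton] at h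
    exact h0 (ContinuousLinearMap.ext fun x => Subsingleton.elim _ _)
  have hsa : IsSelfAdjoint A := IsSelfAdjoint.star_mul_self R
  obtain ⟨μ, hμ, hμn⟩ := spectrum.exists_nnnorm_eq_spectralRadius A
  have hμA : ‖μ‖ = ‖A‖ := by
    rw [hsa.spectralRadius_eq_nnnorm] at hμn
    exact congrArg NNReal.toReal (ENNReal.coe_injective hμn)
  have hμ0 : μ ≠ 0 := by
    rw [← norm_pos_iff, hμA, hAn]; positivity
  obtain ⟨x, hx⟩ := ((hAc.hasEigenvalue_iff_mem_spectrum hμ0).mpr hμ).exists_hasEigenvector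
  have hx0 : x ≠ 0 := hx.2
  have hxn : ‖x‖ ≠ 0 := norm_ne_zero_iff.mpr hx0
  have hAx : A x = μ • x := hx.apply_eq_smul
  set e : H := ((‖x‖⁻¹ : ℝ) : ℂ) • x with he
  have he1 : ‖e‖ = 1 := by rw [he, norm_smul]; simp [hxn]
  have hAe : A e = μ • e := by rw [he, map_smul, hAx, smul_comm]
  refine ⟨e, μ, he1, hμ0, ?_, hAe⟩
  have h1 : ‖R e‖ ^ 2 = ‖R‖ ^ 2 := by
    have h2 : inner ℂ (A e) e = ((‖R e‖ ^ 2 : ℝ) : ℂ) := by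
      rw [hA, mul_apply_eq_comp, ContinuousLinearMap.adjoint_inner_left, inner_self_eq_norm_sq_to_K]
      simp
    rw [hAe, inner_smul_left, inner_self_eq_norm_sq_to_K, he1] at h2
    have h3 := congrArg norm h2
    rw [Complex.norm_of_nonneg (sq_nonneg _)] at h3
    simp [hμA, hAn] at h3
    rw [← h3, sq]
  exact (sq_eq_sq₀ (norm_nonneg _) (norm_nonneg _)).mp h1

/-- Here `e` is a norm-attaining vector of `T` restricted to `Wᗮ`. The last clause keeps the
hypothesis `hW` true once `e` and `f` are added to `W` and `W'`. -/
lemma exists_schmidt_step [CompleteSpace H] (hH : ¬ FiniteDimensional ℂ H) (T : H →L[ℂ] H)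
    (hT : IsCompactOperator T) (W W' : Submodule ℂ H) [FiniteDimensional ℂ W]
    [FiniteDimensional ℂ W'] (hW : ∀ x ∈ Wᗮ, T x ∈ W'ᗮ) :
    ∃ (e f : H) (t : ℝ), e ∈ Wᗮ ∧ f ∈ W'ᗮ ∧ ‖e‖ = 1 ∧ ‖f‖ = 1 ∧ 0 ≤ t ∧ T e = (t : ℂ) • f ∧
      (∀ x ∈ Wᗮ, ‖T x‖ ≤ t * ‖x‖) ∧ ∀ x ∈ Wᗮ, inner ℂ e x = 0 → inner ℂ f (T x) = 0 := by
  set P : H →L[ℂ] H := Wᗮ.starProjection with hP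
  have hPx : ∀ x ∈ Wᗮ, P x = x := fun x hx => Submodule.starProjection_eq_self_iff.mpr hx
  set R : H →L[ℂ] H := T * P with hR
  have hRx : ∀ x ∈ Wᗮ, R x = T x := fun x hx => by rw [hR, mul_apply_eq_comp, hPx x hx]
  by_cases h0 : R = 0
  -- Even if `T` vanishes on `Wᗮ`, infinite dimension supplies unit vectors, so the recursion never
  -- stops and `t = 0` from here on.
  · obtain ⟨e, he, he1⟩ := exists_mem_orthogonal_norm_eq_one hH W
    obtain ⟨f, hf, hf1⟩ := exists_mem_orthogonal_norm_eq_one hH W'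
    have hz : ∀ x ∈ Wᗮ, T x = 0 := fun x hx => by rw [← hRx x hx, h0]; rfl
    exact ⟨e, f, 0, he, hf, he1, hf1, le_rfl, by simp [hz e he], fun x hx => by simp [hz x hx],
      fun x hx _ => by simp [hz x hx]⟩
  · obtain ⟨e, μ, he1, hμ0, hRe, hAe⟩ := exists_singular_vector R (hT.comp_clm P) h0
    have hRpos : 0 < ‖R‖ := norm_pos_iff.mpr h0
    have hadj : ContinuousLinearMap.adjoint R = P * ContinuousLinearMap.adjoint T := by
      have h1 : star R = star P * star T := star_mul T P
      have h2 : star P = P := (isSelfAdjoint_starProjection Wᗮ)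
      rw [h2] at h1
      exact h1
    have he : e ∈ Wᗮ := by
      have : e = μ⁻¹ • P (ContinuousLinearMap.adjoint T (R e)) := by
        rw [← mul_apply_eq_comp, ← hadj, hAe, smul_smul, inv_mul_cancel₀ hμ0, one_smul]
      rw [this]
      exact Submodule.smul_mem _ _ (Submodule.starProjection_apply_mem _ _)
    have hTe : ‖T e‖ = ‖R‖ := by rw [← hRx e he, hRe]
    refine ⟨e, ((‖R‖⁻¹ : ℝ) : ℂ) • T e, ‖R‖, he, Submodule.smul_mem _ _ (hW e he), he1, ?_,
      hRpos.le, ?_, ?_, ?_⟩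
    · rw [norm_smul, hTe]; simp [hRpos.ne']
    · rw [smul_smul, ← Complex.ofReal_mul, mul_inv_cancel₀ hRpos.ne']; simp
    · intro x hx
      rw [← hRx x hx]
      exact R.le_opNorm x
    · intro x hx hex
      rw [inner_smul_left, ← hRx e he, ← hRx x hx, ← ContinuousLinearMap.adjoint_inner_left, hAe,
        inner_smul_left, hex]
      simp

lemma orthonormal_of_lt {e : ℕ → H} (h1 : ∀ n, ‖e n‖ = 1)
    (h : ∀ i j, i < j → inner ℂ (e i) (e j) = 0) : Orthonormal ℂ e := by
  refine ⟨h1, fun i j hij => ?_⟩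
  rcases lt_or_gt_of_ne hij with h2 | h2
  · exact h i j h2
  · exact inner_eq_zero_symm.mp (h j i h2)

/-- The Schmidt step is iterated on pairs `(W, W')` with `T Wᗮ ⊆ W'ᗮ`, starting from zero subspaces.
The vectors `e` need not span `H`; the final norm bound controls `T` on what they miss. -/
lemma exists_schmidt_sequence [CompleteSpace H] (hH : ¬ FiniteDimensional ℂ H) (T : H →L[ℂ] H)
    (hT : IsCompactOperator T) :
    ∃ (e f : ℕ → H) (t : ℕ → ℝ), Orthonormal ℂ e ∧ Orthonormal ℂ f ∧ (∀ n, 0 ≤ t n) ∧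
      (∀ n, T (e n) = (t n : ℂ) • f n) ∧
      ∀ n, ∃ W : Submodule ℂ H, FiniteDimensional ℂ W ∧ Module.finrank ℂ W ≤ n ∧
        (∀ x, (∀ i < n, inner ℂ (e i) x = 0) → x ∈ Wᗮ) ∧ ∀ x ∈ Wᗮ, ‖T x‖ ≤ t n * ‖x‖ := by
  let St := {p : Submodule ℂ H × Submodule ℂ H // FiniteDimensional ℂ p.1 ∧
    FiniteDimensional ℂ p.2 ∧ ∀ x ∈ p.1ᗮ, T x ∈ p.2ᗮ}
  have hstep : ∀ p : St, ∃ (e f : H) (t : ℝ), e ∈ p.1.1ᗮ ∧ f ∈ p.1.2ᗮ ∧ ‖e‖ = 1 ∧ ‖f‖ = 1 ∧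
      0 ≤ t ∧ T e = (t : ℂ) • f ∧ (∀ x ∈ p.1.1ᗮ, ‖T x‖ ≤ t * ‖x‖) ∧
      ∀ x ∈ p.1.1ᗮ, inner ℂ e x = 0 → inner ℂ f (T x) = 0 := by
    rintro ⟨⟨W, W'⟩, h1, h2, h3⟩
    have := h1
    have := h2
    exact exists_schmidt_step hH T hT W W' h3
  choose e f t he hf he1 hf1 ht0 hTe hTx hinv using hstep
  have hsup : ∀ (W : Submodule ℂ H) (y x : H),
      x ∈ (W ⊔ Submodule.span ℂ {y})ᗮ ↔ x ∈ Wᗮ ∧ inner ℂ y x = 0 := by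
    intro W y x
    rw [← Submodule.inf_orthogonal, Submodule.mem_inf, Submodule.mem_orthogonal_singleton_iff_inner_right]
  let nxt : St → St := fun p =>
    ⟨(p.1.1 ⊔ Submodule.span ℂ {e p}, p.1.2 ⊔ Submodule.span ℂ {f p}), by
      have := p.2.1
      have := p.2.2.1
      refine ⟨inferInstance, inferInstance, fun x hx => ?_⟩
      rw [hsup] at hx ⊢
      exact ⟨p.2.2.2 x hx.1, hinv p x hx.1 hx.2⟩⟩
  let st : ℕ → St := fun n => n.rec ⟨(⊥, ⊥), inferInstance, inferInstance, by simp⟩ fun _ p => nxt p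
  have hst : ∀ n, st (n + 1) = nxt (st n) := fun _ => rfl
  have hmono : ∀ m n, m ≤ n → (st m).1.1 ≤ (st n).1.1 ∧ (st m).1.2 ≤ (st n).1.2 := by
    intro m n h
    induction n, h using Nat.le_induction with
    | base => exact ⟨le_rfl, le_rfl⟩
    | succ n _ ih => exact ⟨ih.1.trans le_sup_left, ih.2.trans le_sup_left⟩
  have hmem : ∀ i n, i < n → e (st i) ∈ (st n).1.1 ∧ f (st i) ∈ (st n).1.2 := by
    intro i n h
    have := hmono (i + 1) n h
    exact ⟨this.1 (Submodule.mem_sup_right (Submodule.mem_span_singleton_self _)),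
      this.2 (Submodule.mem_sup_right (Submodule.mem_span_singleton_self _))⟩
  refine ⟨fun n => e (st n), fun n => f (st n), fun n => t (st n), ?_, ?_, fun n => ht0 _,
    fun n => hTe _, fun n => ⟨(st n).1.1, (st n).2.1, ?_, ?_, hTx _⟩⟩
  · exact orthonormal_of_lt (fun n => he1 _) fun i j hij =>
      Submodule.inner_right_of_mem_orthogonal (hmem i j hij).1 (he (st j))
  · exact orthonormal_of_lt (fun n => hf1 _) fun i j hij =>
      Submodule.inner_right_of_mem_orthogonal (hmem i j hij).2 (hf (st j))
  · induction n with
    | zero => simp [st]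
    | succ n ih =>
      have := (st n).2.1
      have h1 : Module.finrank ℂ (Submodule.span ℂ {e (st n)}) ≤ 1 :=
        (finrank_span_singleton (norm_ne_zero_iff.mp (by rw [he1]; exact one_ne_zero))).le
      exact (Submodule.finrank_add_le_finrank_add_finrank _ _).trans (add_le_add ih h1)
  · intro x hx
    induction n with
    | zero => simp [st]
    | succ n ih =>
      rw [hst]
      exact (hsup _ _ _).mpr ⟨ih fun i hi => hx i (hi.trans (Nat.lt_succ_self n)),
        hx n (Nat.lt_succ_self n)⟩

/-- The competitor `T P_W` has rank at most `n`, and `T - T P_W` only sees `Wᗮ`. -/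
lemma singularNumber_le_of_orthogonal [CompleteSpace H] (T : H →L[ℂ] H) (n : ℕ) {c : ℝ}
    (hc : 0 ≤ c) (W : Submodule ℂ H) [FiniteDimensional ℂ W] (hW : Module.finrank ℂ W ≤ n)
    (h : ∀ x ∈ Wᗮ, ‖T x‖ ≤ c * ‖x‖) : singularNumber T n ≤ c := by
  have hrank : ((T * W.starProjection : H →L[ℂ] H) : H →ₗ[ℂ] H).rank ≤ (n : Cardinal) := by
    refine (LinearMap.rank_comp_le_right ((W.starProjection : H →L[ℂ] H) : H →ₗ[ℂ] H)
      (T : H →ₗ[ℂ] H)).trans ?_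
    have h1 : LinearMap.range ((W.starProjection : H →L[ℂ] H) : H →ₗ[ℂ] H) ≤ W := by
      rintro _ ⟨x, rfl⟩
      exact Submodule.starProjection_apply_mem _ _
    refine (Submodule.rank_mono h1).trans ?_
    rw [← Module.finrank_eq_rank]
    exact_mod_cast hW
  refine (singularNumber_le T _ n hrank).trans (ContinuousLinearMap.opNorm_le_bound _ hc fun x => ?_)
  have h1 : x - W.starProjection x ∈ Wᗮ := Submodule.sub_starProjection_mem_orthogonal x
  have h2 : (T - T * W.starProjection) x = T (x - W.starProjection x) := by
    simp
  rw [h2]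
  refine (h _ h1).trans (mul_le_mul_of_nonneg_left ?_ hc)
  have h3 := W.norm_sq_eq_add_norm_sq_starProjection x
  have h4 : Wᗮ.starProjection x = x - W.starProjection x := by
    simp [Submodule.starProjection_orthogonal']
  rw [h4] at h3
  refine le_of_sq_le_sq ?_ (norm_nonneg _)
  nlinarith [sq_nonneg ‖W.starProjection x‖]

lemma abs_singularNumber_le (T : H →L[ℂ] H) (n : ℕ) : |singularNumber T n| ≤ ‖T‖ := by
  rw [abs_of_nonneg (singularNumber_nonneg T n)]
  exact singularNumber_le_norm T n

/-- An operator whose singular numbers tend to `0` generates the same ideal as the diagonal operator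
of its singular numbers. -/
theorem mem_iff_diag_singularNumber_mem [CompleteSpace H] (hH : ¬ FiniteDimensional ℂ H)
    (b : HilbertBasis ℕ ℂ H) (T : H →L[ℂ] H) (hT : Tendsto (singularNumber T) atTop (nhds 0))
    (I : TwoSidedIdeal (H →L[ℂ] H)) : T ∈ I ↔ diag b (singularNumber T) ∈ I := by
  obtain ⟨e, f, t, he, hf, ht0, hTe, hW⟩ :=
    exists_schmidt_sequence hH T (isCompactOperator_of_tendsto_singularNumber T hT)
  choose W hWfin hWrank hWmem hWle using hW
  obtain ⟨U, hU⟩ := exists_apply_basis_eq b e he.2 1 (fun n => (he.1 n).le)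
  obtain ⟨V, hV⟩ := exists_apply_basis_eq b f hf.2 1 (fun n => (hf.1 n).le)
  have hnorm : ∀ n, ‖T (e n)‖ = t n := fun n => by
    rw [hTe, norm_smul, hf.1, mul_one, Complex.norm_of_nonneg (ht0 n)]
  have hbd : ∀ n, |t n| ≤ ‖T‖ := fun n => by
    rw [abs_of_nonneg (ht0 n), ← hnorm n]
    simpa [he.1 n] using T.le_opNorm (e n)
  have hanti : Antitone t := fun m n hmn => by
    have h := hWle m (e n) (hWmem m (e n) fun i hi => he.2 (by omega))
    rwa [hnorm, he.1, mul_one] at h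
  have hadjU : ∀ n, ContinuousLinearMap.adjoint U (e n) = b n := fun n =>
    ext_inner_basis b fun m => by
      rw [ContinuousLinearMap.adjoint_inner_right, hU, inner_basis, orthonormal_iff_ite.mp he]
  have hadjV : ∀ n, ContinuousLinearMap.adjoint V (f n) = b n := fun n =>
    ext_inner_basis b fun m => by
      rw [ContinuousLinearMap.adjoint_inner_right, hV, inner_basis, orthonormal_iff_ite.mp hf]
  have hD : diag b t = ContinuousLinearMap.adjoint V * (T * U) := by
    refine ext_basis b fun n => ?_
    rw [diag_apply b hbd, mul_apply_eq_comp, mul_apply_eq_comp, hU, hTe, map_smul, hadjV]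
  have hst : ∀ n, singularNumber T n ≤ t n := fun n => by
    have := hWfin n
    exact singularNumber_le_of_orthogonal T n (ht0 n) (W n) (hWrank n) (hWle n)
  -- Comparing `t` with `s(T)` up to a constant suffices, since `diag_mem_of_le` absorbs constants.
  set K : ℝ := ‖ContinuousLinearMap.adjoint V‖ * ‖U‖ with hK
  have hts : ∀ n, t n ≤ K * singularNumber T n := fun n => by
    refine (le_singularNumber_diag b hanti ht0 n).trans ?_
    rw [hD, hK, mul_assoc, mul_comm ‖U‖]
    exact (singularNumber_mul_le_left _ _ n).trans
      (mul_le_mul_of_nonneg_left (singularNumber_mul_le_right _ _ n) (norm_nonneg _))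
  have ht : Tendsto t atTop (nhds 0) :=
    squeeze_zero ht0 hts (by simpa using hT.const_mul K)
  have hTD : T = V * diag b t * ContinuousLinearMap.adjoint U := by
    have h1 : T * U = V * diag b t := ext_basis b fun n => by
      rw [mul_apply_eq_comp, mul_apply_eq_comp, hU, hTe, diag_apply b hbd, map_smul, hV]
    rw [← h1]
    ext x
    -- The vector `y` is orthogonal to every `e n`, so `‖T y‖ ≤ t n * ‖y‖` for all `n`, which forces
    -- `T y = 0`. Hence `T = T U U*`.
    set y := x - U (ContinuousLinearMap.adjoint U x) with hy
    have hUU : ∀ z, ContinuousLinearMap.adjoint U (U z) = z := fun z => by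
      have : ContinuousLinearMap.adjoint U * U = 1 := ext_basis b fun n => by
        rw [mul_apply_eq_comp, hU, hadjU]; rfl
      simpa using congrArg (fun A : H →L[ℂ] H => A z) this
    have hUy : ContinuousLinearMap.adjoint U y = 0 := by rw [hy, map_sub, hUU, sub_self]
    have hey : ∀ n, inner ℂ (e n) y = 0 := fun n => by
      rw [← hU, ← ContinuousLinearMap.adjoint_inner_right, hUy, inner_zero_right]
    have hTy : ‖T y‖ ≤ 0 := by
      refine ge_of_tendsto (by simpa using ht.mul_const ‖y‖) (Eventually.of_forall fun n => ?_)
      exact hWle n y (hWmem n y fun i _ => hey i)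
    have hTy0 : T y = 0 := norm_le_zero_iff.mp hTy
    rw [hy, map_sub, sub_eq_zero] at hTy0
    exact hTy0
  constructor
  · intro hTI
    refine diag_mem_of_le b hbd (K := 1) ?_ zero_le_one fun n => ?_
    · rw [hD]
      exact I.mul_mem_left _ _ (I.mul_mem_right _ _ hTI)
    · rw [abs_of_nonneg (ht0 n), abs_of_nonneg (singularNumber_nonneg T n), one_mul]
      exact hst n
  · intro hDI
    rw [hTD]
    refine I.mul_mem_right _ _ (I.mul_mem_left _ _ ?_)
    refine diag_mem_of_le b (abs_singularNumber_le T) hDI (K := K) (by positivity) fun n => ?_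
    rw [abs_of_nonneg (ht0 n), abs_of_nonneg (singularNumber_nonneg T n)]
    exact hts n

/-- An ideal containing an operator whose singular numbers do not tend to `0` is everything. -/
theorem eq_top_of_not_tendsto_singularNumber [CompleteSpace H] (b : HilbertBasis ℕ ℂ H)
    (T : H →L[ℂ] H) (hT : ¬ Tendsto (singularNumber T) atTop (nhds 0))
    (I : TwoSidedIdeal (H →L[ℂ] H)) (hI : T ∈ I) : I = ⊤ := by
  have hbdd : BddBelow (Set.range (singularNumber T)) :=
    ⟨0, by rintro _ ⟨n, rfl⟩; exact singularNumber_nonneg T n⟩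
  set c : ℝ := ⨅ n, singularNumber T n with hc
  have hc0 : 0 < c := by
    refine lt_of_le_of_ne (Real.iInf_nonneg (singularNumber_nonneg T)) fun h => hT ?_
    have := tendsto_atTop_ciInf (singularNumber_antitone T) hbdd
    rwa [← hc, ← h] at this
  have hcn : ∀ n, c ≤ singularNumber T n := fun n => ciInf_le hbdd n
  obtain ⟨e, he, her⟩ := exists_seq_of_forall_finset_exists
    (fun y : H => ‖y‖ = 1 ∧ c / 2 ≤ ‖T y‖)
    (fun x y => inner ℂ x y = 0 ∧ inner ℂ (T x) (T y) = 0) (by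
      intro s _
      let A : H → H := fun x => ContinuousLinearMap.adjoint T (T x)
      -- Orthogonality to `T*T x` as well as to `x` makes the images under `T` orthogonal too.
      let W : Submodule ℂ H := Submodule.span ℂ ((s : Set H) ∪ A '' s)
      have : FiniteDimensional ℂ W :=
        FiniteDimensional.span_of_finite ℂ (s.finite_toSet.union (s.finite_toSet.image A))
      have hex : ∃ y ∈ Wᗮ, c / 2 * ‖y‖ < ‖T y‖ := by
        by_contra! hcon
        have := singularNumber_le_of_orthogonal T (Module.finrank ℂ W) (by positivity) W le_rfl hcon
        linarith [hcn (Module.finrank ℂ W)]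
      obtain ⟨y, hy, hyT⟩ := hex
      have hy0 : ‖y‖ ≠ 0 := by
        intro h
        rw [norm_eq_zero] at h
        simp [h] at hyT
      have hypos : 0 < ‖y‖ := lt_of_le_of_ne (norm_nonneg _) hy0.symm
      have hn : ‖((‖y‖⁻¹ : ℝ) : ℂ)‖ = ‖y‖⁻¹ := by simp
      have hy' : ((‖y‖⁻¹ : ℝ) : ℂ) • y ∈ Wᗮ := Submodule.smul_mem _ _ hy
      refine ⟨((‖y‖⁻¹ : ℝ) : ℂ) • y, ⟨?_, ?_⟩, fun x hx => ⟨?_, ?_⟩⟩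
      · rw [norm_smul, hn, inv_mul_cancel₀ hy0]
      · rw [map_smul, norm_smul, hn, inv_mul_eq_div, le_div_iff₀ hypos]
        exact hyT.le
      · exact Submodule.inner_right_of_mem_orthogonal
          (Submodule.subset_span (Or.inl hx)) hy'
      · rw [← ContinuousLinearMap.adjoint_inner_left]
        exact Submodule.inner_right_of_mem_orthogonal
          (Submodule.subset_span (Or.inr ⟨x, hx, rfl⟩)) hy')
  have heo : Orthonormal ℂ e := orthonormal_of_lt (fun n => (he n).1) fun i j h => (her i j h).1
  have hTo : ∀ i j, i ≠ j → inner ℂ (T (e i)) (T (e j)) = 0 := by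
    intro i j hij
    rcases lt_or_gt_of_ne hij with h | h
    · exact (her i j h).2
    · exact inner_eq_zero_symm.mp (her j i h).2
  have hpos : ∀ n, 0 < ‖T (e n)‖ := fun n => lt_of_lt_of_le (by positivity) (he n).2
  obtain ⟨U, hU⟩ := exists_apply_basis_eq b e heo.2 1 (fun n => (heo.1 n).le)
  -- The scaling gives `⟨G b_m, T e_n⟩ = δ_mn`, so `G* T U = 1`; the lower bound `c / 2` on `‖T
  -- e_n‖` bounds `G`.
  obtain ⟨G, hG⟩ := exists_apply_basis_eq b (fun n => (((‖T (e n)‖ ^ 2)⁻¹ : ℝ) : ℂ) • T (e n))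
    (fun i j hij => by
      simp only [inner_smul_left, inner_smul_right, hTo i j hij, mul_zero]) (c / 2)⁻¹ (fun n => by
      rw [norm_smul, Complex.norm_of_nonneg (by positivity)]
      have h1 : (‖T (e n)‖ ^ 2)⁻¹ * ‖T (e n)‖ = ‖T (e n)‖⁻¹ := by
        have := (hpos n).ne'
        field_simp
      rw [h1]
      exact inv_anti₀ (by positivity) (he n).2)
  have h1 : (1 : H →L[ℂ] H) = ContinuousLinearMap.adjoint G * (T * U) := by
    refine ext_basis b fun n => ext_inner_basis b fun m => ?_
    rw [mul_apply_eq_comp, mul_apply_eq_comp, hU, ContinuousLinearMap.adjoint_inner_right, hG,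
      inner_smul_left]
    change inner ℂ (b m) (b n) = _
    rw [inner_basis]
    split_ifs with h
    · subst h
      rw [inner_self_eq_norm_sq_to_K, Complex.conj_ofReal]
      have h2 := (hpos m).ne'
      have h3 : ((‖T (e m)‖ : ℝ) : ℂ) ≠ 0 := Complex.ofReal_ne_zero.mpr h2
      push_cast
      exact (inv_mul_cancel₀ (pow_ne_zero 2 h3)).symm
    · rw [hTo m n h, mul_zero]
  rw [← TwoSidedIdeal.one_mem_iff, h1]
  exact I.mul_mem_left _ _ (I.mul_mem_right _ _ hI)

/-! ### Ideals -/

theorem diag_singularNumber_mem [CompleteSpace H] (hH : ¬ FiniteDimensional ℂ H)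
    (b : HilbertBasis ℕ ℂ H) {T : H →L[ℂ] H} {I : TwoSidedIdeal (H →L[ℂ] H)} (hT : T ∈ I) :
    diag b (singularNumber T) ∈ I := by
  by_cases h : Tendsto (singularNumber T) atTop (nhds 0)
  · exact (mem_iff_diag_singularNumber_mem hH b T h I).mp hT
  · rw [eq_top_of_not_tendsto_singularNumber b T h I hT]
    trivial

lemma smul_mem_ideal {I : TwoSidedIdeal (H →L[ℂ] H)} (c : ℂ) {X : H →L[ℂ] H} (hX : X ∈ I) :
    c • X ∈ I := by
  rw [← one_mul X, ← smul_mul_assoc]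
  exact I.mul_mem_left _ _ hX

lemma self_mem_principalIdeal (S : H →L[ℂ] H) : S ∈ principalIdeal S :=
  (TwoSidedIdeal.mem_sInf _).mpr fun _ hI => hI

lemma mem_of_mem_principalIdeal {S X : H →L[ℂ] H} (hX : X ∈ principalIdeal S)
    {I : TwoSidedIdeal (H →L[ℂ] H)} (hS : S ∈ I) : X ∈ I :=
  (TwoSidedIdeal.mem_sInf _).mp hX I hS

/-- The two-sided ideal of all operators `X` with `A * X * B ∈ N` for all `A ∈ a` and `B ∈ b`, where
`a` is stable under right and `b` under left multiplication. -/
def idealOf (N : AddSubgroup (H →L[ℂ] H)) (a b : Set (H →L[ℂ] H))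
    (ha : ∀ A ∈ a, ∀ X, A * X ∈ a) (hb : ∀ B ∈ b, ∀ X, X * B ∈ b) :
    TwoSidedIdeal (H →L[ℂ] H) :=
  TwoSidedIdeal.mk' {X | ∀ A ∈ a, ∀ B ∈ b, A * X * B ∈ N}
    (fun A _ B _ => by simp)
    (fun hx hy A hA B hB => by
      simpa [mul_add, add_mul] using N.add_mem (hx A hA B hB) (hy A hA B hB))
    (fun hx A hA B hB => by simpa using N.neg_mem (hx A hA B hB))
    (fun {x y} hy A hA B hB => by simpa [mul_assoc] using hy (A * x) (ha A hA x) B hB)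
    (fun {x y} hx A hA B hB => by simpa [mul_assoc] using hx A hA (y * B) (hb B hB y))

lemma mem_idealOf {N : AddSubgroup (H →L[ℂ] H)} {a b : Set (H →L[ℂ] H)}
    {ha : ∀ A ∈ a, ∀ X, A * X ∈ a} {hb : ∀ B ∈ b, ∀ X, X * B ∈ b} {X : H →L[ℂ] H} :
    X ∈ idealOf N a b ha hb ↔ ∀ A ∈ a, ∀ B ∈ b, A * X * B ∈ N :=
  TwoSidedIdeal.mem_mk' _ _ _ _ _ _ _

/-- If `A * S * B ∈ N` for all `A ∈ a` and `B ∈ b`, where `a` is stable under right and `b` under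
left multiplication, then
the same holds with `S` replaced by any element of `(S)`. -/
lemma mul_mul_mem_of_mem_principalIdeal {N : AddSubgroup (H →L[ℂ] H)} {a b : Set (H →L[ℂ] H)}
    (ha : ∀ A ∈ a, ∀ X, A * X ∈ a) (hb : ∀ B ∈ b, ∀ X, X * B ∈ b) {S X : H →L[ℂ] H}
    (hS : ∀ A ∈ a, ∀ B ∈ b, A * S * B ∈ N) (hX : X ∈ principalIdeal S) :
    ∀ A ∈ a, ∀ B ∈ b, A * X * B ∈ N :=
  mem_idealOf.mp (mem_of_mem_principalIdeal hX (mem_idealOf (ha := ha) (hb := hb).mpr hS))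

lemma mem_idealProd_of_mem {I J : TwoSidedIdeal (H →L[ℂ] H)} {a b : H →L[ℂ] H} (ha : a ∈ I)
    (hb : b ∈ J) : a * b ∈ idealProd I J :=
  ⟨1, fun _ => a, fun _ => b, fun _ => ha, fun _ => hb, by simp⟩

/-- The product of two ideals as an ideal. -/
def idealProdIdeal (I J : TwoSidedIdeal (H →L[ℂ] H)) : TwoSidedIdeal (H →L[ℂ] H) :=
  TwoSidedIdeal.mk' (idealProd I J)
    ⟨0, fun _ => 0, fun _ => 0, fun _ => I.zero_mem, fun _ => J.zero_mem, by simp⟩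
    (by
      rintro x y ⟨n, a, b, ha, hb, rfl⟩ ⟨m, a', b', ha', hb', rfl⟩
      refine ⟨n + m, Fin.append a a', Fin.append b b', fun i => ?_, fun i => ?_, ?_⟩
      · refine Fin.addCases (fun i => ?_) (fun i => ?_) i
        · simpa using ha i
        · simpa using ha' i
      · refine Fin.addCases (fun i => ?_) (fun i => ?_) i
        · simpa using hb i
        · simpa using hb' i
      · simp [Fin.sum_univ_add])
    (by
      rintro x ⟨n, a, b, ha, hb, rfl⟩
      exact ⟨n, fun i => -a i, b, fun i => I.neg_mem (ha i), hb, by simp⟩)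
    (by
      rintro x y ⟨n, a, b, ha, hb, rfl⟩
      exact ⟨n, fun i => x * a i, b, fun i => I.mul_mem_left _ _ (ha i), hb,
        by simp [Finset.mul_sum, mul_assoc]⟩)
    (by
      rintro x y ⟨n, a, b, ha, hb, rfl⟩
      exact ⟨n, a, fun i => b i * y, ha, fun i => J.mul_mem_right _ _ (hb i),
        by simp [Finset.sum_mul, mul_assoc]⟩)

lemma mem_idealProdIdeal {I J : TwoSidedIdeal (H →L[ℂ] H)} {X : H →L[ℂ] H} :
    X ∈ idealProdIdeal I J ↔ X ∈ idealProd I J :=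
  TwoSidedIdeal.mem_mk' _ _ _ _ _ _ _

lemma idealProd_subset_left (I J : TwoSidedIdeal (H →L[ℂ] H)) :
    idealProd I J ⊆ (I : Set (H →L[ℂ] H)) := by
  rintro _ ⟨n, a, b, ha, hb, rfl⟩
  exact sum_mem fun i _ => I.mul_mem_right _ _ (ha i)

lemma idealProd_subset_right (I J : TwoSidedIdeal (H →L[ℂ] H)) :
    idealProd I J ⊆ (J : Set (H →L[ℂ] H)) := by
  rintro _ ⟨n, a, b, ha, hb, rfl⟩
  exact sum_mem fun i _ => J.mul_mem_left _ _ (hb i)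

lemma principalIdeal_subset_idealProd {S : H →L[ℂ] H} {I J : TwoSidedIdeal (H →L[ℂ] H)}
    (h : S ∈ idealProd I J) : (principalIdeal S : Set (H →L[ℂ] H)) ⊆ idealProd I J :=
  fun _ hX => mem_idealProdIdeal.mp (mem_of_mem_principalIdeal hX (mem_idealProdIdeal.mpr h))

/-! ### Operators dominated by the singular numbers of `S` times those of an element of `J` -/

/-- `X` is `J`-dominated by `S`: up to an ampliation, `s(X)` is at most the product of `s(S)` and a
sequence of the characteristic set of `J`. -/
def IsDominated (b : HilbertBasis ℕ ℂ H) (J : TwoSidedIdeal (H →L[ℂ] H)) (S X : H →L[ℂ] H) :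
    Prop :=
  ∃ k : ℕ, 0 < k ∧ ∃ x : ℕ → ℝ, Antitone x ∧ (∀ n, 0 ≤ x n) ∧ diag b x ∈ J ∧
    ∀ n, singularNumber X (k * n) ≤ singularNumber S n * x n

lemma abs_le_of_antitone {x : ℕ → ℝ} (hx : Antitone x) (hx0 : ∀ n, 0 ≤ x n) (n : ℕ) :
    |x n| ≤ x 0 := by
  rw [abs_of_nonneg (hx0 n)]
  exact hx (Nat.zero_le n)

lemma diag_const_mul_mem [CompleteSpace H] {b : HilbertBasis ℕ ℂ H}
    {J : TwoSidedIdeal (H →L[ℂ] H)} {x : ℕ → ℝ} {C : ℝ} (hx : ∀ n, |x n| ≤ C) (hJ : diag b x ∈ J)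
    {c : ℝ} (hc : 0 ≤ c) : diag b (fun n => c * x n) ∈ J :=
  diag_mem_of_le b hx hJ hc fun n => by rw [abs_mul, abs_of_nonneg hc]

/-- The ideal of all operators `J`-dominated by `S`. -/
def dominatedIdeal [CompleteSpace H] (b : HilbertBasis ℕ ℂ H) (J : TwoSidedIdeal (H →L[ℂ] H))
    (S : H →L[ℂ] H) : TwoSidedIdeal (H →L[ℂ] H) :=
  TwoSidedIdeal.mk' {X | IsDominated b J S X}
    ⟨1, one_pos, fun _ => 0, antitone_const, fun _ => le_rfl, by
      have : diag b (fun _ => 0) = 0 := ext_basis b fun n => by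
        rw [diag_apply b (C := 0) (by simp)]; simp
      rw [this]
      exact J.zero_mem, fun n => by
      simpa using singularNumber_le_norm (0 : H →L[ℂ] H) (1 * n)⟩
    (by
      rintro X Y ⟨k, hk, x, hx, hx0, hxJ, hX⟩ ⟨l, hl, y, hy, hy0, hyJ, hY⟩
      refine ⟨k + l, by omega, fun n => x n + y n, hx.add hy, fun n => add_nonneg (hx0 n) (hy0 n),
        ?_, fun n => ?_⟩
      · rw [diag_add b (abs_le_of_antitone hx hx0) (abs_le_of_antitone hy hy0)]
        exact J.add_mem hxJ hyJ
      · rw [add_mul, mul_add]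
        exact (singularNumber_add_le _ _ _ _).trans (add_le_add (hX n) (hY n)))
    (by
      rintro X ⟨k, hk, x, hx, hx0, hxJ, hX⟩
      exact ⟨k, hk, x, hx, hx0, hxJ, fun n => by rw [singularNumber_neg]; exact hX n⟩)
    (by
      rintro A X ⟨k, hk, x, hx, hx0, hxJ, hX⟩
      refine ⟨k, hk, fun n => ‖A‖ * x n, hx.const_mul (norm_nonneg _),
        fun n => mul_nonneg (norm_nonneg _) (hx0 n),
        diag_const_mul_mem (abs_le_of_antitone hx hx0) hxJ (norm_nonneg _), fun n => ?_⟩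
      refine (singularNumber_mul_le_left _ _ _).trans ?_
      rw [mul_left_comm]
      exact mul_le_mul_of_nonneg_left (hX n) (norm_nonneg _))
    (by
      rintro X A ⟨k, hk, x, hx, hx0, hxJ, hX⟩
      refine ⟨k, hk, fun n => ‖A‖ * x n, hx.const_mul (norm_nonneg _),
        fun n => mul_nonneg (norm_nonneg _) (hx0 n),
        diag_const_mul_mem (abs_le_of_antitone hx hx0) hxJ (norm_nonneg _), fun n => ?_⟩
      refine (singularNumber_mul_le_right _ _ _).trans ?_
      rw [mul_left_comm, mul_comm]
      exact mul_le_mul_of_nonneg_left (hX n) (norm_nonneg _))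

lemma mem_dominatedIdeal [CompleteSpace H] {b : HilbertBasis ℕ ℂ H}
    {J : TwoSidedIdeal (H →L[ℂ] H)} {S X : H →L[ℂ] H} :
    X ∈ dominatedIdeal b J S ↔ IsDominated b J S X :=
  TwoSidedIdeal.mem_mk' _ _ _ _ _ _ _

lemma mul_mem_dominatedIdeal [CompleteSpace H] (hH : ¬ FiniteDimensional ℂ H)
    (b : HilbertBasis ℕ ℂ H) {J : TwoSidedIdeal (H →L[ℂ] H)} (S : H →L[ℂ] H) {A : H →L[ℂ] H}
    (hA : A ∈ J) : A * S ∈ dominatedIdeal b J S ∧ S * A ∈ dominatedIdeal b J S := by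
  simp only [mem_dominatedIdeal]
  -- The ampliation factor `2` comes from splitting the index `2n` as `n + n` between the two
  -- factors.
  refine ⟨⟨2, two_pos, singularNumber A, singularNumber_antitone A, singularNumber_nonneg A,
    diag_singularNumber_mem hH b hA, fun n => ?_⟩, ⟨2, two_pos, singularNumber A,
    singularNumber_antitone A, singularNumber_nonneg A, diag_singularNumber_mem hH b hA,
    fun n => ?_⟩⟩
  · rw [two_mul, mul_comm (singularNumber S n)]
    exact singularNumber_mul_le A S n n
  · rw [two_mul]
    exact singularNumber_mul_le S A n n

lemma idealProd_subset_dominatedIdeal [CompleteSpace H] (hH : ¬ FiniteDimensional ℂ H)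
    (b : HilbertBasis ℕ ℂ H) (J : TwoSidedIdeal (H →L[ℂ] H)) (S : H →L[ℂ] H) :
    idealProd (principalIdeal S) J ⊆ dominatedIdeal b J S ∧
      idealProd J (principalIdeal S) ⊆ dominatedIdeal b J S := by
  set K := dominatedIdeal b J S
  let N : AddSubgroup (H →L[ℂ] H) := AddSubgroup.ofClass K
  have hN : ∀ X, X ∈ N ↔ X ∈ K := fun _ => Iff.rfl
  constructor
  · rintro _ ⟨n, x, y, hx, hy, rfl⟩
    refine SetLike.mem_coe.mpr (sum_mem fun i _ => ?_)
    have h := mul_mul_mem_of_mem_principalIdeal (N := N) (a := Set.univ) (b := (J : Set _))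
      (fun _ _ _ => trivial) (fun B hB X => J.mul_mem_left X B hB) (S := S)
      (fun A _ B hB => by
        rw [hN, mul_assoc]
        exact K.mul_mem_left _ _ (mul_mem_dominatedIdeal hH b S hB).2) (hx i) 1 trivial _ (hy i)
    simpa [hN] using h
  · rintro _ ⟨n, x, y, hx, hy, rfl⟩
    refine SetLike.mem_coe.mpr (sum_mem fun i _ => ?_)
    have h := mul_mul_mem_of_mem_principalIdeal (N := N) (a := (J : Set _)) (b := Set.univ)
      (fun A hA X => J.mul_mem_right A X hA) (fun _ _ _ => trivial) (S := S)
      (fun A hA B _ => by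
        rw [hN]
        exact K.mul_mem_right _ _ (mul_mem_dominatedIdeal hH b S hA).1) (hy i) _ (hx i) 1 trivial
    simpa [hN] using h

/-! ### Principal `J`-ideals that are `B(H)`-ideals: eliminating the scalar part -/

/-- The isometries `v` and `w` map the basis onto its even and odd members. A character of `B(H)`
would turn the three relations into `1 + 1 = 1`. -/
lemma exists_isometry_pair [CompleteSpace H] (b : HilbertBasis ℕ ℂ H) :
    ∃ v v' w w' : H →L[ℂ] H, v' * v = 1 ∧ w' * w = 1 ∧ v * v' + w * w' = 1 := by
  have hn : ∀ r, ∃ A : H →L[ℂ] H, ∀ n, A (b n) = b (2 * n + r) := fun r =>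
    exists_apply_basis_eq b _ (fun i j hij => by
      dsimp only
      rw [inner_basis, if_neg]
      omega) 1 (fun n => (b.orthonormal.1 _).le)
  have hn' : ∀ r : ℕ, ∃ A : H →L[ℂ] H, ∀ n, A (b n) = if n % 2 = r then b (n / 2) else 0 :=
    fun r => exists_apply_basis_eq b _ (fun i j hij => by
      dsimp only
      split_ifs with h1 h2
      · rw [inner_basis, if_neg]
        omega
      all_goals simp) 1 (fun n => by
        split_ifs
        · exact (b.orthonormal.1 _).le
        · simp)
  obtain ⟨v, hv⟩ := hn 0
  obtain ⟨w, hw⟩ := hn 1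
  obtain ⟨v', hv'⟩ := hn' 0
  obtain ⟨w', hw'⟩ := hn' 1
  refine ⟨v, v', w, w', ext_basis b fun n => ?_, ext_basis b fun n => ?_, ext_basis b fun n => ?_⟩
  · rw [mul_apply_eq_comp, hv, hv', if_pos (by omega), show (2 * n + 0) / 2 = n by omega]; rfl
  · rw [mul_apply_eq_comp, hw, hw', if_pos (by omega), show (2 * n + 1) / 2 = n by omega]; rfl
  · rw [add_apply, mul_apply_eq_comp, mul_apply_eq_comp, hv', hw']
    change _ = b n
    rcases Nat.mod_two_eq_zero_or_one n with h | h
    · rw [if_pos h, if_neg (by omega), map_zero, add_zero, hv]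
      congr 1; omega
    · rw [if_neg (by omega), if_pos h, map_zero, zero_add, hw]
      congr 1; omega

/-- `B(H)` has no one-dimensional representation: an ideal `K` with `X S ∈ ℂ S + K` for all `X`
contains `S`. -/
lemma mem_of_forall_exists_smul [CompleteSpace H] (b : HilbertBasis ℕ ℂ H)
    (K : TwoSidedIdeal (H →L[ℂ] H)) (S : H →L[ℂ] H)
    (h : ∀ X : H →L[ℂ] H, ∃ c : ℂ, X * S - c • S ∈ K) : S ∈ K := by
  by_contra hS
  have h0 : ∀ c : ℂ, c • S ∈ K → c = 0 := by
    intro c hc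
    by_contra hne
    apply hS
    have := smul_mem_ideal c⁻¹ hc
    rwa [smul_smul, inv_mul_cancel₀ hne, one_smul] at this
  choose φ hφ using h
  have hmul : ∀ X Y, X * Y * S - (φ X * φ Y) • S ∈ K := by
    intro X Y
    have h1 : X * Y * S - (φ X * φ Y) • S = X * (Y * S - φ Y • S) + φ Y • (X * S - φ X • S) := by
      rw [mul_sub, mul_smul_comm, smul_sub, smul_smul, mul_comm (φ Y), mul_assoc]; abel
    rw [h1]
    exact K.add_mem (K.mul_mem_left _ _ (hφ Y)) (smul_mem_ideal _ (hφ X))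
  obtain ⟨v, v', w, w', hv, hw, hvw⟩ := exists_isometry_pair b
  have h1 : ∀ x x' : H →L[ℂ] H, x' * x = 1 → φ x' * φ x = 1 := by
    intro x x' hx
    have h2 := hmul x' x
    rw [hx, one_mul] at h2
    have h3 : S - (φ x' * φ x) • S = (1 - φ x' * φ x) • S := by rw [sub_smul, one_smul]
    rw [h3] at h2
    exact (sub_eq_zero.mp (h0 _ h2)).symm
  -- Modulo `K`, both `v v' S` and `w w' S` equal `S`, while their sum is `S` itself; hence `S ∈ K`.
  have h2 := K.add_mem (hmul v v') (hmul w w')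
  rw [mul_comm (φ v), h1 v v' hv, mul_comm (φ w), h1 w w' hw] at h2
  have h3 : v * v' * S - (1 : ℂ) • S + (w * w' * S - (1 : ℂ) • S) = -S := by
    have : (v * v' + w * w') * S = S := by rw [hvw, one_mul]
    rw [add_mul] at this
    rw [one_smul, sub_add_sub_comm, this]; abel
  rw [h3] at h2
  exact hS (by simpa using K.neg_mem h2)

/-- The operators of `J` lying in `ℂS + K` form a linear `J`-ideal: multiplication by an element of
`J` sends `S` into `K`, so the scalar becomes `0`. -/
lemma principalLinearIn_le [CompleteSpace H] (hH : ¬ FiniteDimensional ℂ H)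
    (b : HilbertBasis ℕ ℂ H) {J : TwoSidedIdeal (H →L[ℂ] H)} {S : H →L[ℂ] H} (hS : S ∈ J)
    {X : H →L[ℂ] H} (hX : X ∈ principalLinearIn J S) :
    ∃ c : ℂ, X - c • S ∈ dominatedIdeal b J S := by
  set K := dominatedIdeal b J S
  let N : AddSubgroup (H →L[ℂ] H) :=
    { carrier := {X | X ∈ J ∧ ∃ c : ℂ, X - c • S ∈ K}
      zero_mem' := ⟨J.zero_mem, 0, by simp⟩
      add_mem' := by
        rintro X Y ⟨hX, c, hc⟩ ⟨hY, d, hd⟩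
        refine ⟨J.add_mem hX hY, c + d, ?_⟩
        rw [add_smul, add_sub_add_comm]
        exact K.add_mem hc hd
      neg_mem' := by
        rintro X ⟨hX, c, hc⟩
        refine ⟨J.neg_mem hX, -c, ?_⟩
        rw [neg_smul, ← neg_sub']
        exact K.neg_mem hc }
  have hN : IsLinearIdealIn J N := by
    refine ⟨⟨fun X hX => hX.1, ?_, ?_⟩, ?_⟩
    · rintro A hA X ⟨hX, c, hc⟩
      refine ⟨J.mul_mem_left _ _ hX, 0, ?_⟩
      have h1 : A * X - (0 : ℂ) • S = A * (X - c • S) + c • (A * S) := by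
        rw [mul_sub, mul_smul_comm, zero_smul]; abel
      rw [h1]
      exact K.add_mem (K.mul_mem_left _ _ hc) (smul_mem_ideal _ (mul_mem_dominatedIdeal hH b S hA).1)
    · rintro A hA X ⟨hX, c, hc⟩
      refine ⟨J.mul_mem_right _ _ hX, 0, ?_⟩
      have h1 : X * A - (0 : ℂ) • S = (X - c • S) * A + c • (S * A) := by
        rw [sub_mul, smul_mul_assoc, zero_smul]; abel
      rw [h1]
      exact K.add_mem (K.mul_mem_right _ _ hc) (smul_mem_ideal _ (mul_mem_dominatedIdeal hH b S hA).2)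
    · rintro d X ⟨hX, c, hc⟩
      refine ⟨smul_mem_ideal _ hX, d * c, ?_⟩
      rw [mul_smul, ← smul_sub]
      exact smul_mem_ideal _ hc
  have hSN : S ∈ N := ⟨hS, 1, by simp⟩
  exact ((AddSubgroup.mem_sInf.mp hX) N ⟨hN, hSN⟩).2

lemma principalRealLinearIn_le_principalLinearIn (J : TwoSidedIdeal (H →L[ℂ] H)) (S : H →L[ℂ] H) :
    principalRealLinearIn J S ≤ principalLinearIn J S :=
  sInf_le_sInf fun _ hI => ⟨⟨hI.1.1, fun r => hI.1.2 r⟩, hI.2⟩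

lemma principalIn_le_principalRealLinearIn (J : TwoSidedIdeal (H →L[ℂ] H)) (S : H →L[ℂ] H) :
    principalIn J S ≤ principalRealLinearIn J S :=
  sInf_le_sInf fun _ hI => ⟨hI.1.1, hI.2⟩

lemma self_mem_principalIn (J : TwoSidedIdeal (H →L[ℂ] H)) (S : H →L[ℂ] H) :
    S ∈ principalIn J S :=
  AddSubgroup.mem_sInf.mpr fun _ hI => hI.2

lemma mem_dominatedIdeal_of_isBHIdeal [CompleteSpace H] (hH : ¬ FiniteDimensional ℂ H)
    (b : HilbertBasis ℕ ℂ H) {J : TwoSidedIdeal (H →L[ℂ] H)} {S : H →L[ℂ] H} (hS : S ∈ J)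
    {L : AddSubgroup (H →L[ℂ] H)} (hSL : S ∈ L) (hL : L ≤ principalLinearIn J S)
    (h : IsBHIdeal L) : S ∈ dominatedIdeal b J S := by
  obtain ⟨K, hK⟩ := h
  have hmem : ∀ X, X ∈ K ↔ X ∈ L := fun X => by
    rw [← SetLike.mem_coe, hK, SetLike.mem_coe]
  refine mem_of_forall_exists_smul b _ S fun X => principalLinearIn_le hH b hS (hL ?_)
  exact (hmem _).mp (K.mul_mem_left _ _ ((hmem _).mpr hSL))

lemma exists_isBigO_of_isDominated [CompleteSpace H] (b : HilbertBasis ℕ ℂ H)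
    {J : TwoSidedIdeal (H →L[ℂ] H)} {S : H →L[ℂ] H} (h : IsDominated b J S S) :
    ∃ T ∈ J, ∃ (k : ℕ) (_ : 0 < k), (singularNumber S) =O[atTop] (fun n =>
      ampliation k (singularNumber S) n * singularNumber T n) := by
  obtain ⟨k, hk, x, hx, hx0, hxJ, hS⟩ := h
  have hxa : Antitone (ampliation k x) := fun m n h => hx (Nat.div_le_div_right h)
  -- Domination controls only indices divisible by `k`; monotonicity replaces `n` by `k * (n / k)`,
  -- at the price of ampliating both factors.
  refine ⟨diag b (ampliation k x), diag_ampliation_mem b (abs_le_of_antitone hx hx0) hk hxJ, k, hk,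
    IsBigO.of_bound 1 (Eventually.of_forall fun n => ?_)⟩
  have h1 : singularNumber S n ≤ singularNumber S (k * (n / k)) :=
    singularNumber_antitone S (Nat.mul_div_le n k)
  have h2 := le_singularNumber_diag b hxa (fun n => hx0 _) n
  rw [one_mul, Real.norm_of_nonneg (singularNumber_nonneg S n)]
  refine le_trans ?_ (le_abs_self _)
  refine h1.trans ((hS (n / k)).trans ?_)
  exact mul_le_mul_of_nonneg_left h2 (singularNumber_nonneg S _)

/-! ### From the singular number estimate back to the ideals -/

lemma mem_idealProd_of_isBigO [CompleteSpace H] (hH : ¬ FiniteDimensional ℂ H)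
    (b : HilbertBasis ℕ ℂ H) {J : TwoSidedIdeal (H →L[ℂ] H)} {S : H →L[ℂ] H} (hS : S ∈ J)
    (h : ∃ T ∈ J, ∃ (k : ℕ) (_ : 0 < k), (singularNumber S) =O[atTop] (fun n =>
      ampliation k (singularNumber S) n * singularNumber T n)) :
    S ∈ idealProd J (principalIdeal S) ∧ S ∈ idealProd (principalIdeal S) J := by
  obtain ⟨T, hT, k, hk, hO⟩ := h
  by_cases hlim : Tendsto (singularNumber S) atTop (nhds 0)
  swap
  · have hJ := eq_top_of_not_tendsto_singularNumber b S hlim J hS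
    subst hJ
    exact ⟨by simpa using mem_idealProd_of_mem (I := ⊤) (a := 1) trivial (self_mem_principalIdeal S),
      by simpa using mem_idealProd_of_mem (J := ⊤) (b := 1) (self_mem_principalIdeal S) trivial⟩
  set s := singularNumber S with hs
  have hs0 : ∀ n, 0 ≤ s n := singularNumber_nonneg S
  -- Adding `s`, allowed because `S ∈ J`, makes `s n` vanish wherever `σ n * τ n` does, so the
  -- eventual bound extends to all `n`.
  set τ : ℕ → ℝ := fun n => singularNumber T n + s n with hτ
  have hτ0 : ∀ n, 0 ≤ τ n := fun n => add_nonneg (singularNumber_nonneg T n) (hs0 n)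
  have hτb : ∀ n, |τ n| ≤ ‖T‖ + ‖S‖ := fun n =>
    (abs_add_le _ _).trans (add_le_add (abs_singularNumber_le T n) (abs_singularNumber_le S n))
  have hτJ : diag b τ ∈ J := by
    rw [hτ, diag_add b (abs_singularNumber_le T) (abs_singularNumber_le S)]
    exact J.add_mem (diag_singularNumber_mem hH b hT) (diag_singularNumber_mem hH b hS)
  set σ : ℕ → ℝ := ampliation k s with hσ
  have hσ0 : ∀ n, 0 ≤ σ n := fun n => hs0 _
  have hσb : ∀ n, |σ n| ≤ ‖S‖ := fun n => abs_singularNumber_le S _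
  have hσS : diag b σ ∈ principalIdeal S :=
    diag_ampliation_mem b (abs_singularNumber_le S) hk
      (diag_singularNumber_mem hH b (self_mem_principalIdeal S))
  have hO' : s =O[atTop] (fun n => σ n * τ n) := by
    refine hO.trans (IsBigO.of_bound 1 (Eventually.of_forall fun n => ?_))
    rw [one_mul, Real.norm_of_nonneg (mul_nonneg (hσ0 n) (singularNumber_nonneg T n)),
      Real.norm_of_nonneg (mul_nonneg (hσ0 n) (hτ0 n))]
    exact mul_le_mul_of_nonneg_left (le_add_of_nonneg_right (hs0 n)) (hσ0 n)
  obtain ⟨C, hC, hbound⟩ := bound_of_isBigO_nat_atTop hO'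
  have hle : ∀ n, |s n| ≤ C * |σ n * τ n| := by
    intro n
    by_cases h0 : σ n * τ n = 0
    · have hsn : s n = 0 := by
        refine le_antisymm ?_ (hs0 n)
        rcases mul_eq_zero.mp h0 with h1 | h1
        · rw [← h1]
          exact singularNumber_antitone S (Nat.div_le_self n k)
        · rw [← h1]
          exact le_add_of_nonneg_left (singularNumber_nonneg T n)
      simp [hsn, h0]
    · exact hbound h0
  have hστ : ∀ n, |σ n * τ n| ≤ ‖S‖ * (‖T‖ + ‖S‖) := fun n => by
    rw [abs_mul]
    exact mul_le_mul (hσb n) (hτb n) (abs_nonneg _) (norm_nonneg _)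
  constructor
  · rw [← mem_idealProdIdeal, mem_iff_diag_singularNumber_mem hH b S hlim]
    refine diag_mem_of_le b hστ ?_ hC.le hle
    rw [mem_idealProdIdeal, show (fun n => σ n * τ n) = fun n => τ n * σ n from
      funext fun n => mul_comm _ _, diag_mul b hτb hσb]
    exact mem_idealProd_of_mem hτJ hσS
  · rw [← mem_idealProdIdeal, mem_iff_diag_singularNumber_mem hH b S hlim]
    refine diag_mem_of_le b hστ ?_ hC.le hle
    rw [mem_idealProdIdeal, diag_mul b hσb hτb]
    exact mem_idealProd_of_mem hσS hτJ

/-- Substituting `(S) ⊆ (S)J` into `S ∈ J(S)` gives `S ∈ J(S)J`, and the products `A S B` with `A, B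
∈ J` generate `J(S)J` additively. -/
lemma mem_closure_of_mem_idealProd {J : TwoSidedIdeal (H →L[ℂ] H)} {S : H →L[ℂ] H}
    (h1 : S ∈ idealProd J (principalIdeal S)) (h2 : S ∈ idealProd (principalIdeal S) J) :
    S ∈ AddSubgroup.closure {X | ∃ A ∈ J, ∃ B ∈ J, X = A * S * B} := by
  set N := AddSubgroup.closure {X | ∃ A ∈ J, ∃ B ∈ J, X = A * S * B}
  have hN : ∀ X ∈ principalIdeal S, ∀ A ∈ J, ∀ B ∈ J, A * X * B ∈ N := fun X hX =>
    mul_mul_mem_of_mem_principalIdeal (N := N) (a := (J : Set _)) (b := (J : Set _))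
      (fun A hA X => J.mul_mem_right A X hA) (fun B hB X => J.mul_mem_left X B hB)
      (fun A hA B hB => AddSubgroup.subset_closure ⟨A, hA, B, hB, rfl⟩) hX
  obtain ⟨n, a, x, ha, hx, hS⟩ := h1
  have hx' : ∀ i, a i * x i ∈ N := by
    intro i
    obtain ⟨m, y, c, hy, hc, hxi⟩ := principalIdeal_subset_idealProd h2 (hx i)
    rw [hxi, Finset.mul_sum]
    refine sum_mem fun j _ => ?_
    rw [← mul_assoc]
    exact hN _ (hy j) _ (ha i) _ (hc j)
  have : ∑ i, a i * x i ∈ N := sum_mem fun i _ => hx' i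
  rwa [← hS] at this

lemma exists_sum_of_mem_closure {J : TwoSidedIdeal (H →L[ℂ] H)} {S X : H →L[ℂ] H}
    (hX : X ∈ AddSubgroup.closure {X | ∃ A ∈ J, ∃ B ∈ J, X = A * S * B}) :
    ∃ (m : ℕ) (_ : 0 < m) (A B : Fin m → (H →L[ℂ] H)), (∀ i, A i ∈ J) ∧ (∀ i, B i ∈ J) ∧
      X = ∑ i, A i * S * B i := by
  induction hX using AddSubgroup.closure_induction with
  | mem X hX =>
    obtain ⟨A, hA, B, hB, rfl⟩ := hX
    exact ⟨1, one_pos, fun _ => A, fun _ => B, fun _ => hA, fun _ => hB, by simp⟩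
  -- The empty sum is excluded by `0 < m`, so zero is written as one vanishing term.
  | zero => exact ⟨1, one_pos, fun _ => 0, fun _ => 0, fun _ => J.zero_mem, fun _ => J.zero_mem,
      by simp⟩
  | add X Y _ _ hX hY =>
    obtain ⟨n, hn, a, b, ha, hb, rfl⟩ := hX
    obtain ⟨m, hm, a', b', ha', hb', rfl⟩ := hY
    refine ⟨n + m, by omega, Fin.append a a', Fin.append b b', fun i => ?_, fun i => ?_, ?_⟩
    · refine Fin.addCases (fun i => ?_) (fun i => ?_) i
      · simpa using ha i
      · simpa using ha' i
    · refine Fin.addCases (fun i => ?_) (fun i => ?_) i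
      · simpa using hb i
      · simpa using hb' i
    · simp [Fin.sum_univ_add]
  | neg X _ hX =>
    obtain ⟨n, hn, a, b, ha, hb, rfl⟩ := hX
    exact ⟨n, hn, fun i => -a i, b, fun i => J.neg_mem (ha i), hb, by simp⟩

/-- Since `A (A' S B') B = (A A') S (B' B)` and the new coefficients stay in `J`, the `J`-ideal `L`
contains `A S B` for all bounded `A` and `B`, hence all of `(S)`. -/
lemma isBHIdeal_of_mem_closure {J : TwoSidedIdeal (H →L[ℂ] H)} {S : H →L[ℂ] H}
    (hSJ : S ∈ AddSubgroup.closure {X | ∃ A ∈ J, ∃ B ∈ J, X = A * S * B})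
    {L : AddSubgroup (H →L[ℂ] H)} (hL : IsIdealIn J L) (hSL : S ∈ L)
    (hmin : ∀ X ∈ L, X ∈ principalIdeal S) : IsBHIdeal L := by
  refine ⟨principalIdeal S, Set.Subset.antisymm (fun X hX => ?_) hmin⟩
  have h : ∀ Y ∈ AddSubgroup.closure {X | ∃ A ∈ J, ∃ B ∈ J, X = A * S * B},
      ∀ A B : H →L[ℂ] H, A * Y * B ∈ L := by
    intro Y hY
    induction hY using AddSubgroup.closure_induction with
    | mem Y hY =>
      obtain ⟨A', hA', B', hB', rfl⟩ := hY
      intro A B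
      have : A * (A' * S * B') * B = A * A' * S * (B' * B) := by simp only [mul_assoc]
      rw [this]
      exact hL.mul_mem_right _ (J.mul_mem_right _ _ hB') _
        (hL.mul_mem_left _ (J.mul_mem_left _ _ hA') _ hSL)
    | zero => intro A B; simp
    | add X Y _ _ hX hY =>
      intro A B
      simpa [mul_add, add_mul] using L.add_mem (hX A B) (hY A B)
    | neg X _ hX =>
      intro A B
      simpa using L.neg_mem (hX A B)
  have h2 := mul_mul_mem_of_mem_principalIdeal (N := L) (a := Set.univ) (b := Set.univ)
    (fun _ _ _ => trivial) (fun _ _ _ => trivial) (fun A _ B _ => h S hSJ A B) hX 1 trivial 1 trivial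
  simpa using h2

lemma isLinearIdealIn_principalIdeal {J : TwoSidedIdeal (H →L[ℂ] H)} {S : H →L[ℂ] H} (hS : S ∈ J) :
    IsLinearIdealIn J (AddSubgroup.ofClass (principalIdeal S)) :=
  ⟨⟨fun _ hX => mem_of_mem_principalIdeal hX hS,
    fun A _ X hX => (principalIdeal S).mul_mem_left A X hX,
    fun A _ X hX => (principalIdeal S).mul_mem_right X A hX⟩,
    fun c _ hX => smul_mem_ideal c hX⟩

lemma mem_principalIdeal_of_mem_principalLinearIn {J : TwoSidedIdeal (H →L[ℂ] H)}
    {S X : H →L[ℂ] H} (hS : S ∈ J) (hX : X ∈ principalLinearIn J S) : X ∈ principalIdeal S :=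
  AddSubgroup.mem_sInf.mp hX _ ⟨isLinearIdealIn_principalIdeal hS, self_mem_principalIdeal S⟩

/-- Nonemptiness matters because the empty infimum is all of `B(H)`, which need not lie in `J`. -/
lemma isIdealIn_sInf {J : TwoSidedIdeal (H →L[ℂ] H)} {s : Set (AddSubgroup (H →L[ℂ] H))}
    (hne : s.Nonempty) (hs : ∀ I ∈ s, IsIdealIn J I) : IsIdealIn J (sInf s) := by
  refine ⟨fun X hX => ?_, fun A hA X hX => ?_, fun A hA X hX => ?_⟩
  · obtain ⟨I, hI⟩ := hne
    exact (hs I hI).subset X (AddSubgroup.mem_sInf.mp hX I hI)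
  · exact AddSubgroup.mem_sInf.mpr fun I hI =>
      (hs I hI).mul_mem_left A hA X (AddSubgroup.mem_sInf.mp hX I hI)
  · exact AddSubgroup.mem_sInf.mpr fun I hI =>
      (hs I hI).mul_mem_right A hA X (AddSubgroup.mem_sInf.mp hX I hI)

end Subideal

end

theorem theorem1 {H : Type*} [NormedAddCommGroup H] [InnerProductSpace ℂ H] [CompleteSpace H]
    [TopologicalSpace.SeparableSpace H] (hH : ¬ FiniteDimensional ℂ H)
    (J : TwoSidedIdeal (H →L[ℂ] H)) (S : H →L[ℂ] H) (hS : S ∈ J) :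
    List.TFAE [
      -- (i), for each of the three kinds of principal `J`-ideal
      Subideal.IsBHIdeal (Subideal.principalIn J S),
      Subideal.IsBHIdeal (Subideal.principalLinearIn J S),
      Subideal.IsBHIdeal (Subideal.principalRealLinearIn J S),
      -- (ii), in the forms `(S) J = (S)` and `(S) = J (S)`
      Subideal.IsSoft J (Subideal.principalIdeal S),
      (Subideal.principalIdeal S : Set (H →L[ℂ] H)) = Subideal.idealProd J (Subideal.principalIdeal S),
      -- (iii)
      ∃ (m : ℕ) (_ : 0 < m) (A B : H →L[ℂ] H) (A' B' : Fin m → (H →L[ℂ] H)),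
        A ∈ J ∧ B ∈ J ∧ (∀ i, A' i ∈ J) ∧ (∀ i, B' i ∈ J) ∧
          S = A * S + S * B + ∑ i, A' i * S * B' i,
      -- (iv)
      ∃ T ∈ J, ∃ (k : ℕ) (_ : 0 < k),
        (Subideal.singularNumber S) =O[atTop] (fun n =>
          Subideal.ampliation k (Subideal.singularNumber S) n * Subideal.singularNumber T n)] := by
  obtain ⟨b⟩ := Subideal.exists_hilbertBasis_nat hH
  have hle1 := Subideal.principalIn_le_principalRealLinearIn J S
  have hle2 := Subideal.principalRealLinearIn_le_principalLinearIn J S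
  have hmem1 := Subideal.self_mem_principalIn J S
  have hlin := Subideal.isLinearIdealIn_principalIdeal hS
  have hself := Subideal.self_mem_principalIdeal S
  have himp : S ∈ Subideal.dominatedIdeal b J S → ∃ T ∈ J, ∃ (k : ℕ) (_ : 0 < k),
      (Subideal.singularNumber S) =O[atTop] (fun n =>
        Subideal.ampliation k (Subideal.singularNumber S) n * Subideal.singularNumber T n) :=
    fun h => Subideal.exists_isBigO_of_isDominated b (Subideal.mem_dominatedIdeal.mp h)
  have hprod := Subideal.idealProd_subset_dominatedIdeal hH b J S
  tfae_have 1 → 7 := fun h => himp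
    (Subideal.mem_dominatedIdeal_of_isBHIdeal hH b hS hmem1 (hle1.trans hle2) h)
  tfae_have 2 → 7 := fun h => himp
    (Subideal.mem_dominatedIdeal_of_isBHIdeal hH b hS (hle2 (hle1 hmem1)) le_rfl h)
  tfae_have 3 → 7 := fun h => himp
    (Subideal.mem_dominatedIdeal_of_isBHIdeal hH b hS (hle1 hmem1) hle2 h)
  tfae_have 4 → 7 := fun h => himp (hprod.1 (by
    rw [Subideal.IsSoft] at h
    rw [h]
    exact hself))
  tfae_have 5 → 7 := fun h => himp (hprod.2 (by
    rw [← h]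
    exact hself))
  tfae_have 6 → 7 := by
    rintro ⟨m, -, A, B, A', B', hA, hB, hA', -, h⟩
    have hK := fun {A} (hA : A ∈ J) => Subideal.mul_mem_dominatedIdeal hH b S hA
    have hmem := add_mem (add_mem (hK hA).1 (hK hB).2)
      (sum_mem fun i (_ : i ∈ Finset.univ) =>
        (Subideal.dominatedIdeal b J S).mul_mem_right _ (B' i) (hK (hA' i)).1)
    rw [← h] at hmem
    exact himp hmem
  tfae_have 7 → 4 := fun h => Set.Subset.antisymm (Subideal.idealProd_subset_left _ _)
    (Subideal.principalIdeal_subset_idealProd (Subideal.mem_idealProd_of_isBigO hH b hS h).2)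
  tfae_have 7 → 5 := fun h => Set.Subset.antisymm
    (Subideal.principalIdeal_subset_idealProd (Subideal.mem_idealProd_of_isBigO hH b hS h).1)
    (Subideal.idealProd_subset_right _ _)
  have hclosure := fun h => Subideal.mem_closure_of_mem_idealProd
    (Subideal.mem_idealProd_of_isBigO hH b hS h).1 (Subideal.mem_idealProd_of_isBigO hH b hS h).2
  tfae_have 7 → 6 := by
    intro h
    obtain ⟨m, hm, A, B, hA, hB, hAB⟩ := Subideal.exists_sum_of_mem_closure (hclosure h)
    -- The one-sided terms of (iii) are not needed: `S` already lies in `J(S)J`.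
    exact ⟨m, hm, 0, 0, A, B, J.zero_mem, J.zero_mem, hA, hB, by simpa using hAB⟩
  have hmin := fun X => Subideal.mem_principalIdeal_of_mem_principalLinearIn (X := X) hS
  tfae_have 7 → 1 := fun h => Subideal.isBHIdeal_of_mem_closure (hclosure h)
    (Subideal.isIdealIn_sInf ⟨_, hlin.1, hself⟩ fun I hI => hI.1) hmem1
    fun X hX => hmin X (hle2 (hle1 hX))
  tfae_have 7 → 2 := fun h => Subideal.isBHIdeal_of_mem_closure (hclosure h)
    (Subideal.isIdealIn_sInf ⟨_, hlin, hself⟩ fun I hI => hI.1.1) (hle2 (hle1 hmem1)) hmin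
  tfae_have 7 → 3 := fun h => Subideal.isBHIdeal_of_mem_closure (hclosure h)
    (Subideal.isIdealIn_sInf ⟨_, ⟨hlin.1, fun r => hlin.2 r⟩, hself⟩ fun I hI => hI.1.1)
    (hle1 hmem1) fun X hX => hmin X (hle2 hX)
  tfae_finish
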